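/- Let $k$ be a field (for instance $\mathbb R$ or $\mathbb C$). An aromatic forest is an isomorphism class of finite directed graphs (self-loops and the empty graph $\mathbf 1$ are allowed) in which every node has at most one outgoing edge; a root is a node without outgoing edge, and an aromatic tree is an aromatic forest with exactly one root. Let $\mathcal{AF}$ and $\mathcal{AT}\subset\mathcal{AF}$ be the sets of aromatic forests and of aromatic trees, let $\bullet\in\mathcal{AT}$ be the graph with one node and no edge, and let $C_{\mathcal{AF}}^*=k^{\mathcal{AF}}$ and $C_{\mathcal{AT}}^*=k^{\mathcal{AT}}$ be the duals of the free vector spaces on these sets; $C_{\mathcal{AT}}^*\subset C_{\mathcal{AF}}^*$ by extension by $0$. Let $\epsilon,\bullet^*$ be the dual basis elements of $\mathbf 1$ and $\bullet$. For $a_1,a_2\in C_{\mathcal{AF}}^*$ the composition product is $(a_1\cdot a_2)(\phi)=\sum_p a_1(P^*(p))\,a_2(R(p))$, the sum being over all splittings $p$ of the vertex set of $\phi$ into two (possibly empty) parts, with induced subgraphs $P^*(p)$ and $R(p)$, such that no edge of $\phi$ goes from $R(p)$ to $P^*(p)$. With this product $C_{\mathcal{AF}}^*$ is an associative algebra with unit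 $\epsilon$, in which $a$ is invertible if and only if $a(\mathbf 1)\ne0$. A partition $p$ of $\phi$ is a partition of the vertices of $\phi$ into classes together with a set of kept edges, each of which joins two vertices of the same class, such that each class with its kept edges is an aromatic tree; $P(p)$ is the multiset of these aromatic trees. The skeleton $\chi(p)\in\mathcal{AF}$ has the classes as nodes and the remaining (cut) edges of $\phi$ as edges between the classes. The trivial partition of an aromatic tree has one class and keeps all edges. For $b\in C_{\mathcal{AT}}^*$ and $a\in C_{\mathcal{AF}}^*$ let $$(b\star a)(\phi)=\sum_{p} a(\chi(p))\prod_{\theta\in P(p)}b(\theta),$$ the sum being over all partitions $p$ of $\phi$. (a) If $a\in C_{\mathcal{AT}}^*$ then $b\star a\in C_{\mathcal{AT}}^*$, and $(C_{\mathcal{AT}}^*,\star)$ is a monoid with identity $\bullet^*$. It acts on $C_{\mathcal{AF}}^*$ by unital algebra morphisms: for all $a,a_1,a_2\in C_{\mathcal{AF}}^*$, $b,c\in C_{\mathcal{AT}}^*$, $\alpha_1,\alpha_2\in k$, $$b\star(\alpha_1a_1+\alpha_2a_2)=\alpha_1\,b\star a_1+\alpha_2\,b\star a_2,\qquad c\star(b\star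 a)=(c\star b)\star a,\qquad b\star\bullet^*=b,\qquad \bullet^*\star a=a,$$ $$b\star(a_1\cdot a_2)=(b\star a_1)\cdot(b\star a_2),\qquad b\star\epsilon=\epsilon,\qquad b\star a^{-1}=(b\star a)^{-1}\ \text{ if } a \text{ is invertible for the product }\cdot.$$ (b) The set $\{b\in C_{\mathcal{AT}}^*: b(\bullet)\neq0\}$ is a group under $\star$. The inverse $b^{\star-1}$ of $b$ is the unique element of $C_{\mathcal{AT}}^*$ with $$b^{\star-1}(\bullet)=\frac1{b(\bullet)},\qquad b^{\star-1}(\tau)=-\frac1{b(\bullet)}\sum_{p\ \text{nontrivial}} b(\chi(p))\prod_{\theta\in P(p)}b^{\star-1}(\theta)\quad(\tau\in\mathcal{AT},\ \tau\neq\bullet),$$ the sum being over all partitions $p$ of $\tau$ other than the trivial one. -/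

import Mathlib

noncomputable section

namespace Aromatic

/-- A finite directed graph (self-loops allowed, possibly without vertices) in which every node has
at most one outgoing edge. `graph.Adj u v` says that there is an edge going out of `u` into `v`. -/
structure Graph : Type 1 where
  V : Type
  finite : Finite V
  graph : Digraph V
  out_unique : ∀ u v w, graph.Adj u v → graph.Adj u w → v = w

attribute [instance] Graph.finite

namespace Graph

/-- A root is a node without outgoing edges. -/
def IsRoot (G : Graph) (u : G.V) : Prop := ∀ w, ¬ G.graph.Adj u w

/-- The graph has exactly one root. -/
def HasOneRoot (G : Graph) : Prop := ∃! r, G.IsRoot r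

/-- Equivalence of directed graphs: a bijection of the vertices that carries one edge set onto the
other. -/
def Iso (G H : Graph) : Prop := Nonempty (G.graph.Adj ≃r H.graph.Adj)

theorem Iso.refl (G : Graph) : Iso G G := ⟨RelIso.refl _⟩

theorem Iso.symm {G H : Graph} : Iso G H → Iso H G := fun ⟨e⟩ => ⟨RelIso.symm e⟩

theorem Iso.trans {G H K : Graph} : Iso G H → Iso H K → Iso G K :=
  fun ⟨e⟩ ⟨f⟩ => ⟨e.trans f⟩

instance isoSetoid : Setoid Graph := ⟨Iso, Iso.refl, Iso.symm, Iso.trans⟩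

/-- The subgraph with vertex set `W` whose edges are the edges of `F` between vertices of `W`. -/
def sub (G : Graph) (W : Set G.V) (F : Digraph G.V) (hF : F ≤ G.graph) : Graph where
  V := W
  finite := inferInstance
  graph := ⟨fun u v => F.Adj u.1 v.1⟩
  out_unique := fun u v w h1 h2 => Subtype.ext (G.out_unique u.1 v.1 w.1 (hF h1) (hF h2))

/-- The subgraph with vertex set `W` and all edges of `G` between vertices of `W`. -/
def induce (G : Graph) (W : Set G.V) : Graph := G.sub W G.graph le_rfl

/-- An admissible partition of the graph `G` into two (possibly empty) subgraphs `R` and `P*`,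
with no edge from `R` to `P*`. It is given by the vertex set of `R`; the vertex set of `P*` is the
complement. -/
@[ext]
structure AdmissiblePartition (G : Graph) where
  R : Set G.V
  no_edge : ∀ u ∈ R, ∀ v ∉ R, ¬ G.graph.Adj u v

instance (G : Graph) : Finite G.AdmissiblePartition :=
  Finite.of_injective (fun p => p.R) fun _ _ h => AdmissiblePartition.ext h

instance (G : Graph) : Fintype G.AdmissiblePartition := Fintype.ofFinite _

/-- The subgraph `R(p)`. -/
def AdmissiblePartition.lower {G : Graph} (p : G.AdmissiblePartition) : Graph := G.induce p.R

/-- The subgraph `P*(p)`. -/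
def AdmissiblePartition.upper {G : Graph} (p : G.AdmissiblePartition) : Graph := G.induce p.Rᶜ

/-- A partition of the graph `G` into subgraphs with exactly one root each. It is given by a
partition of the vertices into classes together with the set of the edges that are kept (not cut);
every kept edge stays within a class, and each class with its kept edges has exactly one root.
Edges inside a class may be cut as well. -/
@[ext]
structure Partition (G : Graph) where
  classes : Setoid G.V
  kept : Digraph G.V
  kept_le : kept ≤ G.graph
  kept_classes : ∀ u v, kept.Adj u v → classes u v
  oneRoot : ∀ B : Quotient classes, (G.sub {v | Quotient.mk classes v = B} kept kept_le).HasOneRoot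

namespace Partition

variable {G : Graph}

instance : Finite G.Partition := by
  have : Finite (Setoid G.V) :=
    Finite.of_injective (fun s : Setoid G.V => (fun u v => s u v : G.V → G.V → Prop))
      fun _ _ h => Setoid.ext fun u v => iff_of_eq (congrFun (congrFun h u) v)
  have : Finite (Digraph G.V) :=
    Finite.of_injective (fun s : Digraph G.V => s.Adj) fun _ _ h => Digraph.ext h
  exact Finite.of_injective (fun p : G.Partition => (p.classes, p.kept)) fun p q h =>
    Partition.ext (congrArg Prod.fst h) (congrArg Prod.snd h)

instance : Fintype G.Partition := Fintype.ofFinite _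

/-- The index type of the subgraphs of the partition. -/
def Index (p : G.Partition) : Type := Quotient p.classes

instance (p : G.Partition) : Finite p.Index := inferInstanceAs (Finite (Quotient p.classes))

instance (p : G.Partition) : Fintype p.Index := Fintype.ofFinite _

/-- The subgraph a vertex belongs to. -/
def toIndex (p : G.Partition) (v : G.V) : p.Index := Quotient.mk p.classes v

/-- The subgraph of the partition with index `B`. -/
def part (p : G.Partition) (B : p.Index) : Graph := G.sub {v | p.toIndex v = B} p.kept p.kept_le

theorem part_hasOneRoot (p : G.Partition) (B : p.Index) : (p.part B).HasOneRoot := p.oneRoot B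

theorem eq_of_cut (p : G.Partition) {u v u' v' : G.V} (h : p.toIndex u = p.toIndex u')
    (h1 : G.graph.Adj u v) (h1' : ¬ p.kept.Adj u v)
    (h2 : G.graph.Adj u' v') (h2' : ¬ p.kept.Adj u' v') : u = u' := by
  have key : ∀ (x y : G.V) (_ : G.graph.Adj x y) (_ : ¬ p.kept.Adj x y) (hx : p.toIndex x = p.toIndex u'),
      (p.part (p.toIndex u')).IsRoot ⟨x, hx⟩ := by
    intro x y h h' hx w hw
    have hw' : p.kept.Adj x w.1 := hw
    have := G.out_unique x y w.1 h (p.kept_le hw')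
    exact h' (this ▸ hw')
  exact congrArg Subtype.val
    ((p.part_hasOneRoot (p.toIndex u')).unique (key u v h1 h1' h) (key u' v' h2 h2' rfl))

/-- The skeleton: each subgraph of the partition is collapsed to a single node, and the cut edges
remain as edges between these nodes. -/
def skeleton (p : G.Partition) : Graph where
  V := p.Index
  finite := inferInstance
  graph := ⟨fun B C => ∃ u v, p.toIndex u = B ∧ p.toIndex v = C ∧
    G.graph.Adj u v ∧ ¬ p.kept.Adj u v⟩
  out_unique := by
    rintro _ _ _ ⟨u, v, rfl, rfl, h1, h1'⟩ ⟨u', v', h, rfl, h2, h2'⟩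
    obtain rfl := p.eq_of_cut h.symm h1 h1' h2 h2'
    rw [G.out_unique _ _ _ h1 h2]

/-- The trivial partition: one subgraph, the whole graph. -/
def IsTrivial (p : G.Partition) : Prop := p.classes = ⊤ ∧ p.kept = G.graph

instance : Fintype {p : G.Partition // ¬ p.IsTrivial} := Fintype.ofFinite _

end Partition

end Graph

/-- Aromatic forests: equivalence classes of finite directed graphs in which each node has at most
one outgoing edge. -/
def AF : Type 1 := Quotient Graph.isoSetoid

/-- The aromatic forest represented by a graph. -/
def Graph.toAF (G : Graph) : AF := Quotient.mk Graph.isoSetoid G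

theorem Graph.toAF_eq {G H : Graph} (e : G.graph.Adj ≃r H.graph.Adj) : G.toAF = H.toAF :=
  Quotient.sound (s := Graph.isoSetoid) ⟨e⟩

theorem Graph.Iso.hasOneRoot {G H : Graph} (h : G.Iso H) (hG : G.HasOneRoot) : H.HasOneRoot := by
  obtain ⟨e⟩ := h
  obtain ⟨r, hr, hu⟩ := hG
  refine ⟨e r, fun w hw => hr (e.symm w) ?_, fun y hy => ?_⟩
  · have := e.symm.map_rel_iff.2 hw
    simpa using this
  · have : e.symm y = r := hu _ fun w hw => hy (e w) (by simpa using e.map_rel_iff.2 hw)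
    rw [← this]; simp

/-- The aromatic forest has exactly one root. -/
def AF.HasOneRoot (φ : AF) : Prop :=
  Quotient.lift Graph.HasOneRoot
    (fun _ _ h => propext ⟨Graph.Iso.hasOneRoot h, Graph.Iso.hasOneRoot (Graph.Iso.symm h)⟩) φ

/-- Aromatic trees: aromatic forests with exactly one root. -/
def AT : Type 1 := {φ : AF // φ.HasOneRoot}

/-- The aromatic tree represented by a graph with exactly one root. -/
def Graph.toAT (G : Graph) (h : G.HasOneRoot) : AT := ⟨G.toAF, h⟩

theorem Graph.toAT_eq {G H : Graph} (e : G.graph.Adj ≃r H.graph.Adj) (hG : G.HasOneRoot)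
    (hH : H.HasOneRoot) : G.toAT hG = H.toAT hH :=
  Subtype.ext (Graph.toAF_eq e)

/-- The empty graph. -/
def Graph.empty : Graph := ⟨Empty, inferInstance, ⊥, fun u => u.elim⟩

/-- The graph with a single node and no edge. -/
def Graph.bullet : Graph := ⟨Unit, inferInstance, ⊥, fun _ _ _ _ _ => rfl⟩

theorem Graph.bullet_hasOneRoot : Graph.bullet.HasOneRoot :=
  ⟨(), fun _ h => h, fun _ _ => rfl⟩

/-- The empty aromatic forest. -/
def AF.empty : AF := Graph.empty.toAF

/-- The aromatic tree with a single node and no edge. -/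
def AT.bullet : AT := Graph.bullet.toAT Graph.bullet_hasOneRoot

/-- The dual of the free vector space over the aromatic forests: series indexed by `AF`. -/
abbrev DualAF (k : Type*) : Type _ := AF → k

/-- The dual of the free vector space over the aromatic trees: series indexed by `AT`. -/
abbrev DualAT (k : Type*) : Type _ := AT → k

variable {k : Type*} [Field k]

open Classical in
/-- A series indexed by aromatic trees as a series indexed by aromatic forests, with the value `0`
on the forests that are not aromatic trees. -/
def DualAT.toAF (b : DualAT k) : DualAF k := fun φ => if h : φ.HasOneRoot then b ⟨φ, h⟩ else 0

open Classical in
/-- The dual basis element of the tree with a single node. -/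
def bulletDual (k : Type*) [Field k] : DualAT k := fun τ => if τ = AT.bullet then 1 else 0

open Classical in
/-- The counit, which is the unit of the composition product. -/
def counit (k : Type*) [Field k] : DualAF k := fun φ => if φ = AF.empty then 1 else 0

/-- The coefficient of the composition product at a graph. -/
def compGraph (a₁ a₂ : DualAF k) (G : Graph) : k :=
  ∑ p : G.AdmissiblePartition, a₁ p.upper.toAF * a₂ p.lower.toAF

/-- The coefficient of the substitution product at a graph. -/
def substGraph (b : DualAT k) (a : DualAF k) (G : Graph) : k :=
  ∑ p : G.Partition, a p.skeleton.toAF * ∏ B : p.Index, b ((p.part B).toAT (p.part_hasOneRoot B))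

/-- Transport of the subgraph construction along an isomorphism. -/
def subIso {G H : Graph} (e : G.V ≃ H.V) {W : Set G.V} {W' : Set H.V}
    {F : Digraph G.V} {F' : Digraph H.V} (hF : F ≤ G.graph) (hF' : F' ≤ H.graph)
    (hW : ∀ v, v ∈ W ↔ e v ∈ W') (hFF : ∀ u v, F'.Adj (e u) (e v) ↔ F.Adj u v) :
    (G.sub W F hF).graph.Adj ≃r (H.sub W' F' hF').graph.Adj where
  toEquiv := e.subtypeEquiv hW
  map_rel_iff' := fun {u v} => hFF u.1 v.1

/-- Transport of admissible partitions along an isomorphism. -/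
def mapAdm {G H : Graph} (e : G.graph.Adj ≃r H.graph.Adj) (p : G.AdmissiblePartition) :
    H.AdmissiblePartition where
  R := {v | e.symm v ∈ p.R}
  no_edge := fun _ hu _ hv h => p.no_edge _ hu _ hv (e.symm.map_rel_iff.2 h)

theorem compGraph_congr (a₁ a₂ : DualAF k) {G H : Graph} (h : G.Iso H) :
    compGraph a₁ a₂ G = compGraph a₁ a₂ H := by
  obtain ⟨e⟩ := h
  refine Fintype.sum_equiv ⟨mapAdm e, mapAdm e.symm, fun p => ?_, fun p => ?_⟩ _ _ fun p => ?_
  · ext v; simp [mapAdm]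
  · ext v; simp [mapAdm]
  · congr 2
    · exact Graph.toAF_eq (subIso e.toEquiv le_rfl le_rfl (by simp [mapAdm]) fun _ _ => e.map_rel_iff)
    · exact Graph.toAF_eq (subIso e.toEquiv le_rfl le_rfl (by simp [mapAdm]) fun _ _ => e.map_rel_iff)

/-- Transport of partitions along an isomorphism. -/
def mapPartition {G H : Graph} (e : G.graph.Adj ≃r H.graph.Adj) (p : G.Partition) :
    H.Partition where
  classes := p.classes.comap e.symm
  kept := ⟨fun u v => p.kept.Adj (e.symm u) (e.symm v)⟩
  kept_le := fun _ _ h => e.symm.map_rel_iff.1 (p.kept_le h)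
  kept_classes := fun _ _ h => p.kept_classes _ _ h
  oneRoot := by
    intro B
    obtain ⟨w, rfl⟩ := Quotient.exists_rep B
    refine Graph.Iso.hasOneRoot ⟨?_⟩ (p.oneRoot (Quotient.mk p.classes (e.symm w)))
    refine subIso e.toEquiv _ _ (fun v => ?_) fun u v => by simp
    change Quotient.mk p.classes v = Quotient.mk p.classes (e.symm w) ↔
      Quotient.mk (p.classes.comap e.symm) (e v) = Quotient.mk (p.classes.comap e.symm) w
    rw [Quotient.eq, Quotient.eq]
    change _ ↔ p.classes (e.symm (e v)) (e.symm w)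
    simp

/-- The bijection between the index types of a partition and of its transport. -/
def indexEquiv {G H : Graph} (e : G.graph.Adj ≃r H.graph.Adj) (p : G.Partition) :
    p.Index ≃ (mapPartition e p).Index :=
  Quotient.congr (ra := p.classes) (rb := (mapPartition e p).classes) e.toEquiv fun u v => by
    change p.classes u v ↔ p.classes (e.symm (e u)) (e.symm (e v))
    simp

theorem indexEquiv_toIndex {G H : Graph} (e : G.graph.Adj ≃r H.graph.Adj) (p : G.Partition)
    (v : G.V) : indexEquiv e p (p.toIndex v) = (mapPartition e p).toIndex (e v) := rfl

theorem substGraph_congr (b : DualAT k) (a : DualAF k) {G H : Graph} (h : G.Iso H) :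
    substGraph b a G = substGraph b a H := by
  obtain ⟨e⟩ := h
  refine Fintype.sum_equiv ⟨mapPartition e, mapPartition e.symm, fun p => ?_, fun p => ?_⟩ _ _
    fun p => ?_
  · refine Graph.Partition.ext (Setoid.ext fun u v => ?_) (Digraph.ext ?_)
    · change p.classes (e.symm (e u)) (e.symm (e v)) ↔ _
      simp
    · funext u v; simp [mapPartition]
  · refine Graph.Partition.ext (Setoid.ext fun u v => ?_) (Digraph.ext ?_)
    · change p.classes (e (e.symm u)) (e (e.symm v)) ↔ _
      simp
    · funext u v; simp [mapPartition]
  · refine congrArg₂ _ (congrArg a (Graph.toAF_eq ⟨indexEquiv e p, fun {B C} => ?_⟩)) ?_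
    · constructor
      · rintro ⟨u, v, hu, hv, h1, h2⟩
        refine ⟨e.symm u, e.symm v, ?_, ?_, e.symm.map_rel_iff.2 h1, h2⟩
        · apply (indexEquiv e p).injective
          refine Eq.trans ?_ hu
          rw [indexEquiv_toIndex, RelIso.apply_symm_apply]; rfl
        · apply (indexEquiv e p).injective
          refine Eq.trans ?_ hv
          rw [indexEquiv_toIndex, RelIso.apply_symm_apply]; rfl
      · rintro ⟨u, v, rfl, rfl, h1, h2⟩
        exact ⟨e u, e v, rfl, rfl, e.map_rel_iff.2 h1, by simpa [mapPartition] using h2⟩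
    · refine Fintype.prod_equiv (indexEquiv e p) _ _ fun B => congrArg b ?_
      refine Graph.toAT_eq (subIso e.toEquiv _ _ (fun v => ?_) fun u v => ?_) _ _
      · change p.toIndex v = B ↔ (mapPartition e p).toIndex (e v) = indexEquiv e p B
        rw [← indexEquiv_toIndex, (indexEquiv e p).apply_eq_iff_eq]
      · simp [mapPartition]

/-- The composition product of two series indexed by aromatic forests: the product dual to the
coproduct `φ ↦ ∑ P*(p) ⊗ R(p)`, the sum being over the admissible partitions `p` of `φ`. -/
def comp (a₁ a₂ : DualAF k) : DualAF k :=
  Quotient.lift (compGraph a₁ a₂) fun _ _ h => compGraph_congr a₁ a₂ h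

/-- The substitution product `b ⋆ a` of a series `b` indexed by aromatic trees and a series `a`
indexed by aromatic forests. -/
def subst (b : DualAT k) (a : DualAF k) : DualAF k :=
  Quotient.lift (substGraph b a) fun _ _ h => substGraph_congr b a h

/-- The substitution product `c ⋆ b` of two series indexed by aromatic trees, as a series indexed by
aromatic trees. -/
def substAT (c b : DualAT k) : DualAT k := fun τ => subst c b.toAF τ.1

/-- `a'` is the two-sided inverse of `a` for the composition product. -/
def IsCompInverse (a a' : DualAF k) : Prop := comp a a' = counit k ∧ comp a' a = counit k

/-- The recursive formula for the inverse `b'` of `b` under the substitution product. The sum is over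
all partitions other than the trivial one; the skeleton of a partition of an aromatic tree is again an
aromatic tree. -/
def IsRecursiveInverse (b b' : DualAT k) : Prop :=
  b' AT.bullet = 1 / b AT.bullet ∧
  ∀ (G : Graph) (hG : G.HasOneRoot), G.toAT hG ≠ AT.bullet →
    b' (G.toAT hG) = -(1 / b AT.bullet) * ∑ p : {p : G.Partition // ¬ p.IsTrivial},
      b.toAF p.1.skeleton.toAF * ∏ B : p.1.Index, b' ((p.1.part B).toAT (p.1.part_hasOneRoot B))

end Aromatic

end

open Aromatic

/-! A partition of a graph into aromatic trees amounts to a choice of root for every vertex. In a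
class with one root, every other vertex keeps its unique outgoing edge and the root keeps none. So
the kept edges are those leaving non-roots and the cut edges are those leaving roots. A partition is
therefore an idempotent self-map `root` such that each non-fixed vertex has an edge into its own
fibre (`RootMap`, `toPartition_bijective`). The skeleton then lives on the fixed vertices, and no
quotient remains.

The identities of (a) are double countings of related pairs. For $c\star(b\star a)=(c\star b)\star
a$, both sides sum over pairs of partitions, $\rho$ finer than $\sigma$, with weights $c$ on the
classes of $\rho$, $b$ on the skeletons of $\rho$ inside the classes of $\sigma$, and $a$ on the
skeleton of $\sigma$. One side fixes $\rho$ and partitions its skeleton (`lift_bijective`); the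
other fixes $\sigma$ and partitions each class (`prod_subst_sub`). For $b\star(a_1\cdot a_2)$ the
pairs consist of a partition and an admissible splitting that cuts through no class
(`pullback_bijective` and again `prod_subst_sub`). Associativity of the composition product counts
chains of lower parts.

Inverses come from triangularity. In $(x\star b)(\tau)$ the trivial partition contributes
$b(\bullet)x(\tau)$ and all other terms use $x$ on smaller trees only. If $b(\bullet)\ne0$,
recursion on the number of nodes gives a unique left inverse, which has a left inverse in turn and
is thus two-sided. The composition product is treated in the same way. -/

noncomputable section

namespace Aromatic

variable {k : Type*} [Field k]

/-! ### Partitions encoded by root maps -/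

namespace Graph

/-- The choice of a root for each class of a partition: an idempotent self-map of the vertices such
that each vertex which is not fixed has an outgoing edge into its own fibre. -/
@[ext]
structure RootMap (G : Graph) where
  root : G.V → G.V
  idem : ∀ v, root (root v) = root v
  adj : ∀ v, root v ≠ v → ∃ w, G.graph.Adj v w ∧ root w = root v

namespace RootMap

variable {G : Graph}

instance : Finite G.RootMap :=
  Finite.of_injective (fun ρ => ρ.root) fun _ _ h => RootMap.ext h

instance : Fintype G.RootMap := Fintype.ofFinite _

theorem root_eq_of_adj (ρ : G.RootMap) {v w : G.V} (h : G.graph.Adj v w) (hv : ρ.root v ≠ v) :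
    ρ.root w = ρ.root v := by
  obtain ⟨w', h', hw'⟩ := ρ.adj v hv
  rwa [G.out_unique _ _ _ h h']

/-- The fixed vertices, which are the roots of the classes. -/
abbrev Fix (ρ : G.RootMap) : Type := {v : G.V // ρ.root v = v}

instance fintypeFix (ρ : G.RootMap) : Fintype ρ.Fix := Fintype.ofFinite _

/-- The edges that go out of a vertex which is not fixed. -/
def kept (ρ : G.RootMap) : Digraph G.V := ⟨fun u v => G.graph.Adj u v ∧ ρ.root u ≠ u⟩

theorem kept_le (ρ : G.RootMap) : ρ.kept ≤ G.graph := fun _ _ h => h.1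

/-- The fibre of a vertex, with the kept edges. -/
def part (ρ : G.RootMap) (r : G.V) : Graph := G.sub {v | ρ.root v = r} ρ.kept ρ.kept_le

/-- The graph on the fixed vertices obtained by collapsing the fibres. -/
abbrev skel (ρ : G.RootMap) : Graph where
  V := ρ.Fix
  finite := inferInstance
  graph := ⟨fun r s => ∃ w, G.graph.Adj r.1 w ∧ ρ.root w = s.1⟩
  out_unique := by
    rintro r s t ⟨w, h, hw⟩ ⟨w', h', hw'⟩
    rw [G.out_unique _ _ _ h h', hw'] at hw
    exact Subtype.ext hw.symm

theorem part_isRoot_iff (ρ : G.RootMap) {r v : G.V} (hv : ρ.root v = r) :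
    (ρ.part r).IsRoot ⟨v, hv⟩ ↔ v = r := by
  constructor
  · intro h
    by_contra hne
    obtain ⟨w, hw, hw'⟩ := ρ.adj v (fun h' => hne (h'.symm.trans hv))
    exact h ⟨w, hw'.trans hv⟩ ⟨hw, fun h' => hne (h'.symm.trans hv)⟩
  · rintro rfl w hw
    exact hw.2 hv

theorem part_hasOneRoot (ρ : G.RootMap) (r : ρ.Fix) : (ρ.part r.1).HasOneRoot :=
  ⟨⟨r.1, r.2⟩, (ρ.part_isRoot_iff r.2).2 rfl,
    fun y hy => Subtype.ext ((ρ.part_isRoot_iff y.2).1 hy)⟩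

theorem root_eq_of_isRoot (ρ : G.RootMap) {v : G.V} (h : G.IsRoot v) : ρ.root v = v := by
  by_contra hne
  obtain ⟨w, hw, -⟩ := ρ.adj v hne
  exact h w hw

theorem skel_isRoot_iff (ρ : G.RootMap) (r : ρ.Fix) :
    ρ.skel.IsRoot r ↔ G.IsRoot r.1 := by
  constructor
  · intro h w hw
    exact h ⟨ρ.root w, ρ.idem w⟩ ⟨w, hw, rfl⟩
  · rintro h s ⟨w, hw, -⟩
    exact h w hw

/-- A root of `G` has no edge to keep, hence is fixed, and an outgoing edge of a fixed vertex always
survives in the skeleton, possibly as a self-loop. So both graphs have the same roots. -/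
theorem skel_hasOneRoot_iff (ρ : G.RootMap) : ρ.skel.HasOneRoot ↔ G.HasOneRoot := by
  constructor
  · rintro ⟨r, hr, hu⟩
    refine ⟨r.1, (ρ.skel_isRoot_iff r).1 hr, fun y hy => ?_⟩
    exact congrArg Subtype.val (hu ⟨y, ρ.root_eq_of_isRoot hy⟩ ((ρ.skel_isRoot_iff _).2 hy))
  · rintro ⟨r, hr, hu⟩
    refine ⟨⟨r, ρ.root_eq_of_isRoot hr⟩, (ρ.skel_isRoot_iff _).2 hr, fun y hy => ?_⟩
    exact Subtype.ext (hu y.1 ((ρ.skel_isRoot_iff y).1 hy))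

/-- The partition into the fibres of a root map. -/
def toPartition (ρ : G.RootMap) : G.Partition where
  classes := Setoid.ker ρ.root
  kept := ρ.kept
  kept_le := ρ.kept_le
  kept_classes := fun _ _ h => (ρ.root_eq_of_adj h.1 h.2).symm
  oneRoot := by
    intro B
    obtain ⟨w, rfl⟩ := Quotient.exists_rep B
    refine Graph.Iso.hasOneRoot ⟨?_⟩ (ρ.part_hasOneRoot ⟨ρ.root w, ρ.idem w⟩)
    refine subIso (Equiv.refl _) _ _ (fun v => ?_) fun u v => Iff.rfl
    change ρ.root v = ρ.root w ↔
      Quotient.mk (Setoid.ker ρ.root) v = Quotient.mk (Setoid.ker ρ.root) w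
    rw [Quotient.eq]
    rfl

theorem toPartition_toIndex_eq_iff (ρ : G.RootMap) {u v : G.V} :
    ρ.toPartition.toIndex u = ρ.toPartition.toIndex v ↔ ρ.root u = ρ.root v := by
  change Quotient.mk (Setoid.ker ρ.root) u = Quotient.mk (Setoid.ker ρ.root) v ↔ _
  rw [Quotient.eq]
  rfl

theorem toPartition_bijective : Function.Bijective (toPartition (G := G)) := by
  constructor
  · intro ρ σ h
    have hc : ∀ u v, ρ.root u = ρ.root v ↔ σ.root u = σ.root v := by
      intro u v
      have h1 : Setoid.ker ρ.root = Setoid.ker σ.root := congrArg Partition.classes h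
      exact iff_of_eq (congrArg (fun s : Setoid G.V => s u v) h1)
    have hk : ∀ u v, ρ.kept.Adj u v ↔ σ.kept.Adj u v := by
      intro u v
      have h1 : ρ.kept = σ.kept := congrArg Partition.kept h
      rw [h1]
    -- A vertex moved by `σ` has an edge kept by `σ`, hence by `ρ`, so `ρ` moves it too.
    have hfix : ∀ v, ρ.root v = v → σ.root v = v := by
      intro v hv
      by_contra hne
      obtain ⟨w, hw, -⟩ := σ.adj v hne
      exact ((hk v w).2 ⟨hw, hne⟩).2 hv
    ext v
    rw [← (hc (ρ.root v) v).1 (ρ.idem v), hfix _ (ρ.idem v)]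
  · intro p
    choose f hf hfu using fun B : p.Index => p.part_hasOneRoot B
    have hidx : ∀ v, p.toIndex (f (p.toIndex v)).1 = p.toIndex v := fun v => (f (p.toIndex v)).2
    -- Uniqueness of the root of a class: the vertices other than the root are exactly those with a
    -- kept outgoing edge.
    have hfix : ∀ v, (f (p.toIndex v)).1 ≠ v ↔ ∃ w, p.kept.Adj v w := by
      intro v
      constructor
      · intro hne
        by_contra hno
        refine hne (congrArg Subtype.val (hfu (p.toIndex v) ⟨v, rfl⟩ fun w hw => hno ⟨w.1, hw⟩)).symm
      · rintro ⟨w, hw⟩ h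
        have hr := hf (p.toIndex v)
        refine hr ⟨w, ?_⟩ ?_
        · exact (Quotient.sound (s := p.classes) (p.kept_classes _ _ hw)).symm
        · change p.kept.Adj (f (p.toIndex v)).1 w
          rwa [h]
    refine ⟨⟨fun v => (f (p.toIndex v)).1, fun v => ?_, fun v hv => ?_⟩, ?_⟩
    · rw [hidx]
    · obtain ⟨w, hw⟩ := (hfix v).1 hv
      refine ⟨w, p.kept_le hw, ?_⟩
      rw [show p.toIndex w = p.toIndex v from
        (Quotient.sound (s := p.classes) (p.kept_classes _ _ hw)).symm]
    · refine Partition.ext (Setoid.ext fun u v => ?_) (Digraph.ext ?_)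
      · change (f (p.toIndex u)).1 = (f (p.toIndex v)).1 ↔ _
        rw [← Quotient.eq (r := p.classes)]
        change _ ↔ p.toIndex u = p.toIndex v
        constructor
        · intro h
          rw [← hidx u, h, hidx v]
        · intro h
          rw [h]
      · funext u v
        refine propext ⟨fun h => ?_, fun h => ⟨p.kept_le h, (hfix u).2 ⟨v, h⟩⟩⟩
        obtain ⟨w, hw⟩ := (hfix u).1 h.2
        rwa [G.out_unique _ _ _ h.1 (p.kept_le hw)]

/-- The fixed vertices index the classes. -/
def fixEquivIndex (ρ : G.RootMap) : ρ.Fix ≃ ρ.toPartition.Index :=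
  Equiv.ofBijective (fun r => ρ.toPartition.toIndex r.1) <| by
    constructor
    · intro r s h
      have := ρ.toPartition_toIndex_eq_iff.1 h
      rw [r.2, s.2] at this
      exact Subtype.ext this
    · intro B
      obtain ⟨w, rfl⟩ := Quotient.exists_rep B
      exact ⟨⟨ρ.root w, ρ.idem w⟩, ρ.toPartition_toIndex_eq_iff.2 (ρ.idem w)⟩

theorem toPartition_skeleton_toAF (ρ : G.RootMap) :
    ρ.toPartition.skeleton.toAF = ρ.skel.toAF := by
  refine (Graph.toAF_eq ⟨ρ.fixEquivIndex, fun {r s} => ?_⟩).symm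
  constructor
  · rintro ⟨u, v, hu, hv, h, h'⟩
    have hu' := ρ.toPartition_toIndex_eq_iff.1 hu
    have hv' := ρ.toPartition_toIndex_eq_iff.1 hv
    rw [r.2] at hu'
    rw [s.2] at hv'
    have hfix : ρ.root u = u := by
      by_contra hne
      exact h' ⟨h, hne⟩
    refine ⟨v, ?_, hv'⟩
    rw [← hu', hfix]
    exact h
  · rintro ⟨w, hw, hw'⟩
    exact ⟨r.1, w, rfl, ρ.toPartition_toIndex_eq_iff.2 (hw'.trans s.2.symm), hw,
      fun h => h.2 r.2⟩

theorem toPartition_part_toAF (ρ : G.RootMap) (r : ρ.Fix) :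
    (ρ.toPartition.part (ρ.fixEquivIndex r)).toAF = (ρ.part r.1).toAF := by
  refine Graph.toAF_eq (subIso (Equiv.refl _) _ _ (fun v => ?_) fun u v => Iff.rfl)
  change ρ.toPartition.toIndex v = ρ.toPartition.toIndex r.1 ↔ ρ.root v = r.1
  rw [toPartition_toIndex_eq_iff, r.2]

end RootMap

end Graph

/-! ### The products as sums over root maps -/

theorem DualAT.toAF_toAF (b : DualAT k) {G : Graph} (hG : G.HasOneRoot) :
    b.toAF G.toAF = b (G.toAT hG) := dif_pos hG

theorem DualAT.toAF_eq_zero (b : DualAT k) {G : Graph} (hG : ¬ G.HasOneRoot) :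
    b.toAF G.toAF = 0 := dif_neg hG

theorem DualAT.toAF_injective : Function.Injective (DualAT.toAF (k := k)) := by
  intro b c h
  funext ⟨φ, hφ⟩
  have := congrFun h φ
  simpa [DualAT.toAF, hφ] using this

theorem DualAF.ext_graph {S : Type*} {a a' : DualAF S} (h : ∀ G : Graph, a G.toAF = a' G.toAF) : a = a' := by
  funext φ
  obtain ⟨G, rfl⟩ := Quotient.exists_rep φ
  exact h G

theorem substGraph_eq_sum_rootMap (b : DualAT k) (a : DualAF k) (G : Graph) :
    substGraph b a G =
      ∑ ρ : G.RootMap, a ρ.skel.toAF * ∏ r : ρ.Fix, b.toAF (ρ.part r.1).toAF := by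
  symm
  refine Fintype.sum_bijective _ Graph.RootMap.toPartition_bijective _ _ fun ρ => ?_
  rw [ρ.toPartition_skeleton_toAF]
  congr 1
  refine Fintype.prod_equiv ρ.fixEquivIndex _ _ fun r => ?_
  rw [← ρ.toPartition_part_toAF, DualAT.toAF_toAF]

theorem subst_toAF (b : DualAT k) (a : DualAF k) (G : Graph) :
    subst b a G.toAF =
      ∑ ρ : G.RootMap, a ρ.skel.toAF * ∏ r : ρ.Fix, b.toAF (ρ.part r.1).toAF :=
  substGraph_eq_sum_rootMap b a G

theorem comp_toAF (a₁ a₂ : DualAF k) (G : Graph) :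
    comp a₁ a₂ G.toAF = ∑ p : G.AdmissiblePartition, a₁ p.upper.toAF * a₂ p.lower.toAF :=
  rfl

/-- On a graph without exactly one root no skeleton has exactly one root either, so every term
vanishes. -/
theorem substAT_toAF (c b : DualAT k) : (substAT c b).toAF = subst c b.toAF := by
  refine DualAF.ext_graph fun G => ?_
  by_cases hG : G.HasOneRoot
  · rw [DualAT.toAF_toAF _ hG]
    rfl
  · rw [DualAT.toAF_eq_zero _ hG, subst_toAF]
    refine (Finset.sum_eq_zero fun ρ _ => ?_).symm
    rw [DualAT.toAF_eq_zero _ (fun h => hG (ρ.skel_hasOneRoot_iff.1 h)), zero_mul]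

/-- The double counting behind the action law, the morphism property and associativity of the
composition product. -/
theorem sum_sum_related_comm {X Y M : Type*} [Fintype X] [Fintype Y] [AddCommMonoid M]
    (r : X → Y → Prop) [∀ x, Fintype {y // r x y}] [∀ y, Fintype {x // r x y}] (f : X → Y → M) :
    ∑ x, ∑ y : {y // r x y}, f x y.1 = ∑ y, ∑ x : {x // r x y}, f x.1 y := by
  classical
  have h1 : ∀ x, ∑ y : {y // r x y}, f x y.1 = ∑ y, if r x y then f x y else 0 := by
    intro x
    rw [← Finset.sum_filter, Finset.sum_subtype (Finset.univ.filter (r x)) (p := r x) (by simp) (f x)]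
  have h2 : ∀ y, ∑ x : {x // r x y}, f x.1 y = ∑ x, if r x y then f x y else 0 := by
    intro y
    rw [← Finset.sum_filter, Finset.sum_subtype (Finset.univ.filter fun x => r x y) (p := fun x => r x y) (by simp)
      (fun x => f x y)]
  simp only [h1, h2]
  exact Finset.sum_comm

/-! ### Restricting and gluing root maps -/

namespace Graph.RootMap

variable {G : Graph}

/-- The restriction of a root map to a subgraph that is a union of fibres. -/
def restrict (ρ : G.RootMap) (W : Set G.V) (F : Digraph G.V) (hF : F ≤ G.graph)
    (hW : ∀ v, ρ.root v ∈ W ↔ v ∈ W)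
    (hρ : ∀ u v, ρ.root u ≠ u → G.graph.Adj u v → F.Adj u v) : (G.sub W F hF).RootMap where
  root v := ⟨ρ.root v.1, (hW v.1).2 v.2⟩
  idem v := Subtype.ext (ρ.idem v.1)
  adj v hv := by
    have hne : ρ.root v.1 ≠ v.1 := fun h => hv (Subtype.ext h)
    obtain ⟨w, hw, hw'⟩ := ρ.adj v.1 hne
    refine ⟨⟨w, ?_⟩, hρ _ _ hne hw, Subtype.ext hw'⟩
    rw [← hW, hw', hW]
    exact v.2

/-- The subgraph of the skeleton on the fixed vertices in `W`, with the edges that come from `F`. -/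
def skelSub (ρ : G.RootMap) (W : Set G.V) (F : Digraph G.V) (hF : F ≤ G.graph) : Graph :=
  ρ.skel.sub {y | y.1 ∈ W} ⟨fun y z => ∃ w, F.Adj y.1 w ∧ ρ.root w = z.1⟩
    fun _ _ ⟨w, h, hw⟩ => ⟨w, hF h, hw⟩

section restrict

variable (ρ : G.RootMap) (W : Set G.V) (F : Digraph G.V) (hF : F ≤ G.graph)
  (hW : ∀ v, ρ.root v ∈ W ↔ v ∈ W) (hρ : ∀ u v, ρ.root u ≠ u → G.graph.Adj u v → F.Adj u v)

/-- The fixed vertices of a restriction. -/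
def restrictFixEquiv : (ρ.restrict W F hF hW hρ).Fix ≃ {y : ρ.Fix // y.1 ∈ W} where
  toFun s := ⟨⟨s.1.1, congrArg Subtype.val s.2⟩, s.1.2⟩
  invFun y := ⟨⟨y.1.1, y.2⟩, Subtype.ext y.1.2⟩
  left_inv _ := rfl
  right_inv _ := rfl

theorem restrict_skel_toAF :
    (ρ.restrict W F hF hW hρ).skel.toAF = (ρ.skelSub W F hF).toAF := by
  refine Graph.toAF_eq ⟨ρ.restrictFixEquiv W F hF hW hρ, fun {r s} => ?_⟩
  constructor
  · rintro ⟨w, h, hw⟩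
    refine ⟨⟨w, ?_⟩, h, Subtype.ext hw⟩
    rw [← hW, hw]
    exact s.1.2
  · rintro ⟨w, h, hw⟩
    exact ⟨w.1, h, congrArg Subtype.val hw⟩

theorem restrict_part_toAF (s : (G.sub W F hF).V) :
    ((ρ.restrict W F hF hW hρ).part s).toAF = (ρ.part s.1).toAF := by
  refine Graph.toAF_eq ⟨⟨fun v => ⟨v.1.1, congrArg Subtype.val v.2⟩,
    fun v => ⟨⟨v.1, (hW v.1).1 ?_⟩, Subtype.ext v.2⟩, fun _ => rfl, fun _ => rfl⟩, fun {u v} => ?_⟩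
  · rw [show ρ.root v.1 = s.1 from v.2]
    exact s.2
  · constructor
    · rintro ⟨h, hu⟩
      exact ⟨hρ _ _ hu h, fun h' => hu (congrArg Subtype.val h')⟩
    · rintro ⟨h, hu⟩
      exact ⟨hF h, fun h' => hu (Subtype.ext h')⟩

end restrict

/-- A root map is compatible with the subgraphs cut out by the fibres of `π` and the edges in `F`. -/
def Compatible {ι : Type*} (π : G.V → ι) (F : Digraph G.V) (ρ : G.RootMap) : Prop :=
  (∀ v, π (ρ.root v) = π v) ∧ ∀ u v, ρ.root u ≠ u → G.graph.Adj u v → F.Adj u v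

instance {ι : Type*} (π : G.V → ι) (F : Digraph G.V) :
    Fintype {ρ : G.RootMap // ρ.Compatible π F} := Fintype.ofFinite _

theorem Compatible.mem_iff {ι : Type*} {π : G.V → ι} {F : Digraph G.V} {ρ : G.RootMap}
    (h : ρ.Compatible π F) {W : ι → Set G.V} (hW : ∀ i v, v ∈ W i ↔ π v = i) (i : ι) (v : G.V) :
    ρ.root v ∈ W i ↔ v ∈ W i := by
  rw [hW, hW, h.1]

section family

variable {ι : Type*} (π : G.V → ι) (F : Digraph G.V) (hF : F ≤ G.graph) (W : ι → Set G.V)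
  (hW : ∀ i v, v ∈ W i ↔ π v = i)

/-- The restrictions of a compatible root map to the members of a family of subgraphs. -/
def restrictFamily (ρ : {ρ : G.RootMap // ρ.Compatible π F}) (i : ι) :
    (G.sub (W i) F hF).RootMap :=
  ρ.1.restrict (W i) F hF (ρ.2.mem_iff hW i) ρ.2.2

include hW in
theorem restrictFamily_bijective : Function.Bijective (restrictFamily π F hF W hW) := by
  constructor
  · intro ρ σ h
    refine Subtype.ext (RootMap.ext (funext fun v => ?_))
    have h1 := congrArg RootMap.root (congrFun h (π v))
    exact congrArg Subtype.val (congrFun h1 ⟨v, (hW _ _).2 rfl⟩)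
  · intro τ
    -- The glued map uses at each vertex the root map of the unique member containing it.
    let f : G.V → G.V := fun v => ((τ (π v)).root ⟨v, (hW _ _).2 rfl⟩).1
    have hf : ∀ (i : ι) (v : G.V) (hv : v ∈ W i), f v = ((τ i).root ⟨v, hv⟩).1 := by
      intro i v hv
      obtain rfl := (hW i v).1 hv
      rfl
    have hπ : ∀ v, π (f v) = π v := fun v =>
      (hW _ _).1 ((τ (π v)).root ⟨v, (hW _ _).2 rfl⟩).2
    have hadj : ∀ v, f v ≠ v → ∃ w, F.Adj v w ∧ f w = f v := by
      intro v hv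
      obtain ⟨w, hw, hw'⟩ := (τ (π v)).adj ⟨v, (hW _ _).2 rfl⟩ fun h => hv (congrArg Subtype.val h)
      exact ⟨w.1, hw, (hf (π v) w.1 w.2).trans (congrArg Subtype.val hw')⟩
    refine ⟨⟨⟨f, fun v => ?_, fun v hv => ?_⟩, hπ, fun u v hu huv => ?_⟩, ?_⟩
    · rw [hf (π v) (f v) ((hW _ _).2 (hπ v))]
      exact congrArg Subtype.val ((τ (π v)).idem ⟨v, (hW _ _).2 rfl⟩)
    · obtain ⟨w, hw, hw'⟩ := hadj v hv
      exact ⟨w, hF hw, hw'⟩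
    · obtain ⟨w, hw, -⟩ := hadj u hu
      rwa [G.out_unique _ _ _ huv (hF hw)]
    · funext i
      refine RootMap.ext (funext fun v => Subtype.ext ?_)
      exact hf i v.1 v.2

include hW in
-- Expanding the product of sums gives a sum over families of root maps, one on each subgraph, and
-- such families glue to compatible root maps of `G`. The factors of `c` recombine by sorting the
-- fixed vertices by their value under `π`.
theorem prod_subst_sub [Fintype ι] (c : DualAT k) (A : ι → DualAF k) :
    ∏ i, subst c (A i) (G.sub (W i) F hF).toAF =
      ∑ ρ : {ρ : G.RootMap // ρ.Compatible π F},
        (∏ i, A i (ρ.1.skelSub (W i) F hF).toAF) * ∏ r : ρ.1.Fix, c.toAF (ρ.1.part r.1).toAF := by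
  classical
  simp only [subst_toAF]
  rw [Finset.prod_univ_sum, Fintype.piFinset_univ]
  symm
  refine Fintype.sum_bijective _ (restrictFamily_bijective π F hF W hW) _ _ fun ρ => ?_
  rw [Finset.prod_mul_distrib]
  congr 1
  · exact Finset.prod_congr rfl fun i _ => congrArg (A i) (ρ.1.restrict_skel_toAF _ _ _ _ _).symm
  · rw [← Fintype.prod_fiberwise (fun r : ρ.1.Fix => π r.1)]
    refine Finset.prod_congr rfl fun i _ => ?_
    refine Fintype.prod_equiv ((Equiv.subtypeEquivRight fun r : ρ.1.Fix => (hW i r.1).symm).trans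
      (ρ.1.restrictFixEquiv (W i) F hF (ρ.2.mem_iff hW i) ρ.2.2).symm) _ _ fun r => ?_
    exact congrArg _ (ρ.1.restrict_part_toAF (W i) F hF (ρ.2.mem_iff hW i) ρ.2.2
      ⟨r.1.1, (hW i r.1.1).2 r.2⟩).symm

end family

/-! ### Partitions of a skeleton and the action law -/

/-- The map of a vertex to the fixed vertex of its fibre. -/
def toFix (σ : G.RootMap) (v : G.V) : σ.Fix := ⟨σ.root v, σ.idem v⟩

/-- The composite of a root map and a root map of its skeleton. -/
def lift (ρ : G.RootMap) (q : ρ.skel.RootMap) : G.RootMap where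
  root v := (q.root (ρ.toFix v)).1
  idem v := by
    have h : ρ.toFix (q.root (ρ.toFix v)).1 = q.root (ρ.toFix v) :=
      Subtype.ext (q.root (ρ.toFix v)).2
    rw [h, q.idem]
  adj v hv := by
    -- If `ρ` fixes `v`, an edge of the skeleton provides an edge out of `v`; otherwise the edge
    -- provided by `ρ` stays in the fibre, where the composite is constant.
    by_cases h : ρ.root v = v
    · have h' : ρ.toFix v = ⟨v, h⟩ := Subtype.ext h
      rw [h'] at hv
      obtain ⟨w, ⟨w', hw, hw'⟩, hq⟩ := q.adj ⟨v, h⟩ fun h'' => hv (congrArg Subtype.val h'')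
      refine ⟨w', hw, ?_⟩
      rw [h', show ρ.toFix w' = w from Subtype.ext hw', hq]
    · obtain ⟨w, hw, hw'⟩ := ρ.adj v h
      exact ⟨w, hw, by rw [show ρ.toFix w = ρ.toFix v from Subtype.ext hw']⟩

theorem lift_root (ρ : G.RootMap) (q : ρ.skel.RootMap) (y : ρ.Fix) :
    (ρ.lift q).root y.1 = (q.root y).1 := by
  change (q.root (ρ.toFix y.1)).1 = _
  rw [show ρ.toFix y.1 = y from Subtype.ext y.2]

theorem lift_compatible (ρ : G.RootMap) (q : ρ.skel.RootMap) :
    ρ.Compatible (ρ.lift q).toFix (ρ.lift q).kept := by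
  refine ⟨fun v => Subtype.ext ?_, fun u v hu huv => ⟨huv, fun h => hu ?_⟩⟩
  · exact ρ.lift_root q (ρ.toFix v)
  · rw [← h]
    exact (q.root (ρ.toFix u)).2

instance (ρ : G.RootMap) : Fintype {σ : G.RootMap // ρ.Compatible σ.toFix σ.kept} :=
  Fintype.ofFinite _

/-- If `ρ` moved a root of `σ`, the outgoing edge kept by `ρ` would be kept by `σ`, but `σ` cuts
every edge that leaves a root. -/
theorem Compatible.root_root {ρ σ : G.RootMap} (h : ρ.Compatible σ.toFix σ.kept) (v : G.V) :
    ρ.root (σ.root v) = σ.root v := by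
  by_contra hne
  obtain ⟨w, hw, -⟩ := ρ.adj _ hne
  exact (h.2 _ _ hne hw).2 (σ.idem v)

theorem Compatible.root_root' {ρ σ : G.RootMap} (h : ρ.Compatible σ.toFix σ.kept) (v : G.V) :
    σ.root (ρ.root v) = σ.root v :=
  congrArg Subtype.val (h.1 v)

/-- Restricting a coarser root map to the roots of `ρ` recovers the root map of the skeleton. -/
theorem lift_bijective (ρ : G.RootMap) :
    Function.Bijective fun q : ρ.skel.RootMap =>
      (⟨ρ.lift q, ρ.lift_compatible q⟩ : {σ : G.RootMap // ρ.Compatible σ.toFix σ.kept}) := by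
  constructor
  · intro q q' h
    refine RootMap.ext (funext fun y => Subtype.ext ?_)
    have h1 : ρ.lift q = ρ.lift q' := congrArg Subtype.val h
    rw [← lift_root, ← lift_root, h1]
  · rintro ⟨σ, h⟩
    refine ⟨⟨fun y => ⟨σ.root y.1, h.root_root y.1⟩, fun y => Subtype.ext (σ.idem y.1),
      fun y hy => ?_⟩, ?_⟩
    · obtain ⟨w, hw, hw'⟩ := σ.adj y.1 fun h' => hy (Subtype.ext h')
      exact ⟨ρ.toFix w, ⟨w, hw, rfl⟩, Subtype.ext ((h.root_root' w).trans hw')⟩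
    · exact Subtype.ext (RootMap.ext (funext fun v => h.root_root' v))

/-- The fixed vertices of a composite root map. -/
def liftFixEquiv (ρ : G.RootMap) (q : ρ.skel.RootMap) : q.Fix ≃ (ρ.lift q).Fix where
  toFun y := ⟨y.1.1, (ρ.lift_root q y.1).trans (congrArg Subtype.val y.2)⟩
  invFun v := ⟨⟨v.1, by rw [← v.2]; exact (q.root _).2⟩, Subtype.ext <| by
    rw [← lift_root]; exact v.2⟩
  left_inv _ := rfl
  right_inv _ := rfl

theorem lift_skel_toAF (ρ : G.RootMap) (q : ρ.skel.RootMap) :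
    q.skel.toAF = (ρ.lift q).skel.toAF := by
  refine Graph.toAF_eq ⟨ρ.liftFixEquiv q, fun {r s} => ?_⟩
  constructor
  · rintro ⟨w, hw, hw'⟩
    exact ⟨ρ.toFix w, ⟨w, hw, rfl⟩, Subtype.ext hw'⟩
  · rintro ⟨w, ⟨w', hw, hw'⟩, hq⟩
    refine ⟨w', hw, ?_⟩
    change (q.root (ρ.toFix w')).1 = _
    rw [show ρ.toFix w' = w from Subtype.ext hw', hq]
    rfl

theorem lift_part_toAF (ρ : G.RootMap) (q : ρ.skel.RootMap) (y : ρ.skel.V) :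
    (q.part y).toAF =
      (ρ.skelSub {v | (ρ.lift q).root v = y.1} (ρ.lift q).kept (ρ.lift q).kept_le).toAF := by
  refine Graph.toAF_eq (subIso (Equiv.refl _) _ _ (fun v => ?_) fun u v => ?_)
  · change q.root v = y ↔ (ρ.lift q).root v.1 = y.1
    rw [lift_root, Subtype.ext_iff]
  · have h : (ρ.lift q).root u.1 ≠ u.1 ↔ q.root u ≠ u := by
      rw [lift_root, Ne, Ne, Subtype.ext_iff]
    constructor
    · rintro ⟨w, ⟨hw, hu⟩, hw'⟩
      exact ⟨⟨w, hw, hw'⟩, h.1 hu⟩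
    · rintro ⟨⟨w, hw, hw'⟩, hu⟩
      exact ⟨w, ⟨hw, h.2 hu⟩, hw'⟩

end Graph.RootMap

open Graph.RootMap in
theorem subst_subst (b c : DualAT k) (a : DualAF k) :
    subst c (subst b a) = subst (substAT c b) a := by
  refine DualAF.ext_graph fun G => ?_
  -- The common weight of a pair with `ρ` finer than `σ`.
  let f : G.RootMap → G.RootMap → k := fun ρ σ =>
    a σ.skel.toAF * ((∏ x : σ.Fix,
      b.toAF (ρ.skelSub {v | σ.root v = x.1} σ.kept σ.kept_le).toAF) *
        ∏ r : ρ.Fix, c.toAF (ρ.part r.1).toAF)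
  have h1 : ∀ ρ : G.RootMap, subst b a ρ.skel.toAF * ∏ r : ρ.Fix, c.toAF (ρ.part r.1).toAF =
      ∑ σ : {σ : G.RootMap // ρ.Compatible σ.toFix σ.kept}, f ρ σ.1 := by
    intro ρ
    rw [subst_toAF, Finset.sum_mul]
    refine Fintype.sum_bijective _ ρ.lift_bijective _ _ fun q => ?_
    rw [mul_assoc, ρ.lift_skel_toAF q]
    congr 2
    let : Fintype q.Fix := fintypeFix q
    exact Fintype.prod_equiv (ρ.liftFixEquiv q) _ _ fun y => congrArg _ (ρ.lift_part_toAF q y.1)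
  have h2 : ∀ σ : G.RootMap, a σ.skel.toAF *
      ∏ x : σ.Fix, (substAT c b).toAF (σ.part x.1).toAF =
      ∑ ρ : {ρ : G.RootMap // ρ.Compatible σ.toFix σ.kept}, f ρ.1 σ := by
    intro σ
    rw [substAT_toAF, ← Finset.mul_sum]
    congr 1
    exact prod_subst_sub σ.toFix σ.kept σ.kept_le (fun x : σ.Fix => {v | σ.root v = x.1})
      (fun x v => by rw [Subtype.ext_iff]; rfl) c fun _ => b.toAF
  rw [subst_toAF, subst_toAF, Finset.sum_congr rfl fun ρ _ => h1 ρ,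
    Finset.sum_congr rfl fun σ _ => h2 σ]
  exact sum_sum_related_comm (fun ρ σ : G.RootMap => ρ.Compatible σ.toFix σ.kept) f

/-! ### Substitution is multiplicative for the composition product -/

namespace Graph.RootMap

variable {G : Graph}

/-- The classes of a partition do not cross an admissible partition. -/
def Saturated (ρ : G.RootMap) (p : G.AdmissiblePartition) : Prop :=
  ∀ v, ρ.root v ∈ p.R ↔ v ∈ p.R

instance (ρ : G.RootMap) : Fintype {p : G.AdmissiblePartition // ρ.Saturated p} :=
  Fintype.ofFinite _

instance (p : G.AdmissiblePartition) : Fintype {ρ : G.RootMap // ρ.Saturated p} :=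
  Fintype.ofFinite _

/-- The admissible partition of a graph given by an admissible partition of a skeleton. -/
def pullback (ρ : G.RootMap) (p : ρ.skel.AdmissiblePartition) : G.AdmissiblePartition where
  R := {v | ρ.toFix v ∈ p.R}
  no_edge u hu v hv h := by
    -- An edge leaving a root gives an edge of the skeleton, while any other edge stays in its fibre
    -- and crosses nothing.
    by_cases hne : ρ.root u = u
    · exact p.no_edge _ hu _ hv ⟨v, by change G.graph.Adj (ρ.root u) v; rwa [hne], rfl⟩
    · refine hv ?_
      change ρ.toFix v ∈ p.R
      rwa [show ρ.toFix v = ρ.toFix u from Subtype.ext (ρ.root_eq_of_adj h hne)]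

theorem toFix_coe (ρ : G.RootMap) (y : ρ.Fix) : ρ.toFix y.1 = y := Subtype.ext y.2

theorem pullback_saturated (ρ : G.RootMap) (p : ρ.skel.AdmissiblePartition) :
    ρ.Saturated (ρ.pullback p) := fun v =>
  iff_of_eq (congrArg (· ∈ p.R) (ρ.toFix_coe (ρ.toFix v)))

theorem mem_pullback (ρ : G.RootMap) (p : ρ.skel.AdmissiblePartition) (y : ρ.Fix) :
    y.1 ∈ (ρ.pullback p).R ↔ y ∈ p.R :=
  iff_of_eq (congrArg (· ∈ p.R) (ρ.toFix_coe y))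

theorem pullback_bijective (ρ : G.RootMap) :
    Function.Bijective fun p : ρ.skel.AdmissiblePartition =>
      (⟨ρ.pullback p, ρ.pullback_saturated p⟩ :
        {p : G.AdmissiblePartition // ρ.Saturated p}) := by
  constructor
  · intro p p' h
    have h1 : ρ.pullback p = ρ.pullback p' := congrArg Subtype.val h
    refine AdmissiblePartition.ext (Set.ext fun y => ?_)
    rw [← mem_pullback, ← mem_pullback, h1]
  · rintro ⟨p, hp⟩
    refine ⟨⟨{y | y.1 ∈ p.R}, ?_⟩, ?_⟩
    · rintro u hu v hv ⟨w, hw, hw'⟩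
      refine p.no_edge _ hu w (fun hwR => hv ?_) hw
      change v.1 ∈ p.R
      rwa [← hw', hp]
    · exact Subtype.ext (AdmissiblePartition.ext (Set.ext fun v => hp v))

theorem pullback_lower (ρ : G.RootMap) (p : ρ.skel.AdmissiblePartition) :
    p.lower.toAF = (ρ.skelSub (ρ.pullback p).R G.graph le_rfl).toAF :=
  Graph.toAF_eq (subIso (Equiv.refl _) le_rfl _ (fun y => (ρ.mem_pullback p y).symm) fun _ _ => Iff.rfl)

theorem pullback_upper (ρ : G.RootMap) (p : ρ.skel.AdmissiblePartition) :
    p.upper.toAF = (ρ.skelSub (ρ.pullback p).Rᶜ G.graph le_rfl).toAF :=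
  Graph.toAF_eq (subIso (Equiv.refl _) le_rfl _ (fun y => not_congr (ρ.mem_pullback p y).symm)
    fun _ _ => Iff.rfl)

end Graph.RootMap

open Graph.RootMap in
theorem subst_comp (b : DualAT k) (a₁ a₂ : DualAF k) :
    subst b (comp a₁ a₂) = comp (subst b a₁) (subst b a₂) := by
  classical
  refine DualAF.ext_graph fun G => ?_
  let f : G.RootMap → G.AdmissiblePartition → k := fun ρ p =>
    (a₁ (ρ.skelSub p.Rᶜ G.graph le_rfl).toAF * a₂ (ρ.skelSub p.R G.graph le_rfl).toAF) *
      ∏ r : ρ.Fix, b.toAF (ρ.part r.1).toAF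
  have h1 : ∀ ρ : G.RootMap, comp a₁ a₂ ρ.skel.toAF * ∏ r : ρ.Fix, b.toAF (ρ.part r.1).toAF =
      ∑ p : {p : G.AdmissiblePartition // ρ.Saturated p}, f ρ p.1 := by
    intro ρ
    rw [comp_toAF, Finset.sum_mul]
    refine Fintype.sum_bijective _ ρ.pullback_bijective _ _ fun p => ?_
    rw [ρ.pullback_lower p, ρ.pullback_upper p]
  have h2 : ∀ p : G.AdmissiblePartition, subst b a₁ p.upper.toAF * subst b a₂ p.lower.toAF =
      ∑ ρ : {ρ : G.RootMap // ρ.Saturated p}, f ρ.1 p := by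
    intro p
    -- A family of two subgraphs: `true` selects the upper part and `false` the lower. All edges are
    -- allowed, so compatibility reduces to saturation.
    have h := prod_subst_sub (fun v => decide (v ∉ p.R)) G.graph le_rfl
      (fun i : Bool => if i then p.Rᶜ else p.R) (fun i v => by cases i <;> simp) b
      (fun i : Bool => if i then a₁ else a₂)
    simp only [Fintype.prod_bool, if_true, Bool.false_eq_true, if_false] at h
    refine h.trans (Fintype.sum_equiv (Equiv.subtypeEquivRight fun ρ => ?_) _ _ fun ρ => rfl)
    simp only [Compatible, Saturated, decide_eq_decide, not_iff_not]
    exact ⟨fun h => h.1, fun h => ⟨h, fun _ _ _ h => h⟩⟩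
  rw [subst_toAF, comp_toAF, Finset.sum_congr rfl fun ρ _ => h1 ρ,
    Finset.sum_congr rfl fun σ _ => h2 σ]
  exact sum_sum_related_comm (fun (ρ : G.RootMap) p => ρ.Saturated p) f

/-! ### Associativity of the composition product -/

namespace Graph

theorem induce_induce_toAF (G : Graph) (W T : Set G.V) (S : Set (G.induce W).V)
    (h : ∀ v, v ∈ T ↔ ∃ hv : v ∈ W, (⟨v, hv⟩ : (G.induce W).V) ∈ S) :
    ((G.induce W).induce S).toAF = (G.induce T).toAF :=
  Graph.toAF_eq ⟨⟨fun v => ⟨v.1.1, (h _).2 ⟨v.1.2, v.2⟩⟩,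
    fun v => ⟨⟨v.1, ((h _).1 v.2).1⟩, ((h _).1 v.2).2⟩, fun _ => rfl, fun _ => rfl⟩, Iff.rfl⟩

namespace AdmissiblePartition

variable {G : Graph}

instance (p : G.AdmissiblePartition) :
    Fintype {p' : G.AdmissiblePartition // p.R ⊆ p'.R} := Fintype.ofFinite _

instance (p' : G.AdmissiblePartition) :
    Fintype {p : G.AdmissiblePartition // p.R ⊆ p'.R} := Fintype.ofFinite _

/-- The union of the lower part with the lower part of the upper part. -/
def ofUpper (p : G.AdmissiblePartition) (q : p.upper.AdmissiblePartition) :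
    G.AdmissiblePartition where
  R := {v | ∀ hv : v ∈ p.Rᶜ, (⟨v, hv⟩ : (G.induce p.Rᶜ).V) ∈ q.R}
  no_edge u hu v hv h := by
    obtain ⟨hv, hvq⟩ := not_forall.1 hv
    by_cases hup : u ∈ p.R
    · exact p.no_edge u hup v hv h
    · exact q.no_edge _ (hu hup) _ hvq h

theorem ofUpper_bijective (p : G.AdmissiblePartition) :
    Function.Bijective fun q : p.upper.AdmissiblePartition =>
      (⟨p.ofUpper q, fun _ hv hv' => absurd hv hv'⟩ :
        {p' : G.AdmissiblePartition // p.R ⊆ p'.R}) := by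
  constructor
  · intro q q' h
    have h1 : p.ofUpper q = p.ofUpper q' := congrArg Subtype.val h
    have h2 : ∀ (q : p.upper.AdmissiblePartition) (v : p.upper.V),
        v ∈ q.R ↔ v.1 ∈ (p.ofUpper q).R := fun q v => ⟨fun h _ => h, fun h => h v.2⟩
    exact AdmissiblePartition.ext (Set.ext fun v => by rw [h2, h2, h1])
  · rintro ⟨p', hp⟩
    refine ⟨⟨{v | v.1 ∈ p'.R}, fun u hu v hv h => p'.no_edge u.1 hu v.1 hv h⟩, ?_⟩
    refine Subtype.ext (AdmissiblePartition.ext (Set.ext fun v => ?_))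
    exact ⟨fun h => by_contra fun hv => hv (h fun hv' => hv (hp hv')), fun h _ => h⟩

/-- The lower part of the lower part. -/
def ofLower (p : G.AdmissiblePartition) (q : p.lower.AdmissiblePartition) :
    G.AdmissiblePartition where
  R := {v | ∃ hv : v ∈ p.R, (⟨v, hv⟩ : (G.induce p.R).V) ∈ q.R}
  no_edge u hu v hv h := by
    obtain ⟨hu, huq⟩ := hu
    by_cases hvp : v ∈ p.R
    · exact q.no_edge _ huq ⟨v, hvp⟩ (fun h' => hv ⟨hvp, h'⟩) h
    · exact p.no_edge u hu v hvp h

theorem ofLower_bijective (p : G.AdmissiblePartition) :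
    Function.Bijective fun q : p.lower.AdmissiblePartition =>
      (⟨p.ofLower q, fun _ hv => hv.1⟩ : {p' : G.AdmissiblePartition // p'.R ⊆ p.R}) := by
  constructor
  · intro q q' h
    have h1 : p.ofLower q = p.ofLower q' := congrArg Subtype.val h
    have h2 : ∀ (q : p.lower.AdmissiblePartition) (v : p.lower.V),
        v ∈ q.R ↔ v.1 ∈ (p.ofLower q).R := fun q v => ⟨fun h => ⟨v.2, h⟩, fun h => h.2⟩
    exact AdmissiblePartition.ext (Set.ext fun v => by rw [h2, h2, h1])
  · rintro ⟨p', hp⟩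
    refine ⟨⟨{v | v.1 ∈ p'.R}, fun u hu v hv h => p'.no_edge u.1 hu v.1 hv h⟩, ?_⟩
    refine Subtype.ext (AdmissiblePartition.ext (Set.ext fun v => ?_))
    exact ⟨fun h => h.2, fun h => ⟨hp h, h⟩⟩

theorem ofUpper_upper (p : G.AdmissiblePartition) (q : p.upper.AdmissiblePartition) :
    q.upper.toAF = (p.ofUpper q).upper.toAF :=
  G.induce_induce_toAF _ _ _ fun _ => not_forall

theorem ofUpper_lower (p : G.AdmissiblePartition) (q : p.upper.AdmissiblePartition) :
    q.lower.toAF = (G.induce ((p.ofUpper q).R \ p.R)).toAF :=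
  G.induce_induce_toAF _ _ _ fun _ => ⟨fun h => ⟨h.2, h.1 h.2⟩, fun h => ⟨fun _ => h.2, h.1⟩⟩

theorem ofLower_lower (p : G.AdmissiblePartition) (q : p.lower.AdmissiblePartition) :
    q.lower.toAF = (p.ofLower q).lower.toAF :=
  G.induce_induce_toAF _ _ _ fun _ => Iff.rfl

theorem ofLower_upper (p : G.AdmissiblePartition) (q : p.lower.AdmissiblePartition) :
    q.upper.toAF = (G.induce (p.R \ (p.ofLower q).R)).toAF :=
  G.induce_induce_toAF _ _ _ fun _ =>
    ⟨fun h => ⟨h.1, fun h' => h.2 ⟨h.1, h'⟩⟩, fun h => ⟨h.1, fun h' => h.2 h'.2⟩⟩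

end AdmissiblePartition

end Graph

/-- Both sides sum over chains `p.R ⊆ p'.R`, that is, over splittings into three layers: `a₃` on
`p.R`, `a₂` on the difference and `a₁` on the complement of `p'.R`. -/
theorem comp_assoc (a₁ a₂ a₃ : DualAF k) : comp (comp a₁ a₂) a₃ = comp a₁ (comp a₂ a₃) := by
  refine DualAF.ext_graph fun G => ?_
  let f : G.AdmissiblePartition → G.AdmissiblePartition → k := fun p p' =>
    a₁ p'.upper.toAF * (a₂ (G.induce (p'.R \ p.R)).toAF * a₃ p.lower.toAF)
  have h1 : ∀ p : G.AdmissiblePartition, comp a₁ a₂ p.upper.toAF * a₃ p.lower.toAF =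
      ∑ p' : {p' : G.AdmissiblePartition // p.R ⊆ p'.R}, f p p'.1 := by
    intro p
    rw [comp_toAF, Finset.sum_mul]
    refine Fintype.sum_bijective _ p.ofUpper_bijective _ _ fun q => ?_
    rw [mul_assoc, p.ofUpper_lower, p.ofUpper_upper]
  have h2 : ∀ p' : G.AdmissiblePartition, a₁ p'.upper.toAF * comp a₂ a₃ p'.lower.toAF =
      ∑ p : {p : G.AdmissiblePartition // p.R ⊆ p'.R}, f p.1 p' := by
    intro p
    rw [comp_toAF, Finset.mul_sum]
    refine Fintype.sum_bijective _ p.ofLower_bijective _ _ fun q => ?_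
    rw [p.ofLower_lower, p.ofLower_upper]
  rw [comp_toAF, comp_toAF, Finset.sum_congr rfl fun p _ => h1 p,
    Finset.sum_congr rfl fun p _ => h2 p]
  exact sum_sum_related_comm (fun p p' : G.AdmissiblePartition => p.R ⊆ p'.R) f

/-! ### Unit, linearity and inverses -/

theorem Graph.iso_of_toAF_eq {G H : Graph} (h : G.toAF = H.toAF) :
    Nonempty (G.graph.Adj ≃r H.graph.Adj) :=
  Quotient.exact (s := Graph.isoSetoid) h

theorem Graph.toAF_eq_empty_iff (G : Graph) : G.toAF = AF.empty ↔ IsEmpty G.V := by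
  constructor
  · intro h
    obtain ⟨e⟩ := Graph.iso_of_toAF_eq h
    exact ⟨fun v => (e v).elim⟩
  · intro h
    exact Graph.toAF_eq ⟨⟨fun v => h.elim v, fun v => v.elim, fun v => h.elim v, fun v => v.elim⟩,
      fun {u} => h.elim u⟩

theorem Graph.subsingleton_of_toAF_eq_bullet {G : Graph} (h : G.toAF = Graph.bullet.toAF) :
    Subsingleton G.V := by
  obtain ⟨e⟩ := Graph.iso_of_toAF_eq h
  exact e.injective.subsingleton (β := Unit)

theorem Graph.toAF_eq_bullet {G : Graph} (r : G.V) (hr : ∀ v, v = r)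
    (h : ∀ u v, ¬ G.graph.Adj u v) : G.toAF = Graph.bullet.toAF :=
  Graph.toAF_eq ⟨⟨fun _ => (), fun _ => r, fun v => (hr v).symm, fun _ => rfl⟩,
    fun {u v} => ⟨fun h' => h'.elim, fun h' => (h u v h').elim⟩⟩

theorem sum_eq_add_sum_not {X M : Type*} [Fintype X] [AddCommMonoid M] (P : X → Prop)
    [Fintype {x // ¬ P x}] (a : X) (ha : ∀ x, P x ↔ x = a) (f : X → M) :
    ∑ x, f x = f a + ∑ x : {x // ¬ P x}, f x.1 := by
  classical
  rw [← Finset.add_sum_erase _ f (Finset.mem_univ a),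
    Finset.sum_subtype (Finset.univ.erase a) (p := fun x => ¬ P x) (fun x => by simp [ha]) f]

instance (G : Graph) : Fintype {p : G.AdmissiblePartition // ¬ p.R = Set.univ} :=
  Fintype.ofFinite _

theorem comp_toAF_eq_add (a x : DualAF k) (G : Graph) :
    comp a x G.toAF = a AF.empty * x G.toAF +
      ∑ p : {p : G.AdmissiblePartition // ¬ p.R = Set.univ},
        a p.1.upper.toAF * x p.1.lower.toAF := by
  rw [comp_toAF, sum_eq_add_sum_not (fun p : G.AdmissiblePartition => p.R = Set.univ)
    ⟨Set.univ, fun _ _ _ hv => absurd trivial hv⟩ fun p =>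
      ⟨fun h => Graph.AdmissiblePartition.ext h, fun h => congrArg Graph.AdmissiblePartition.R h⟩]
  congr 2
  · exact congrArg a ((Graph.toAF_eq_empty_iff _).2 ⟨fun v => v.2 trivial⟩)
  · exact congrArg x (Graph.toAF_eq ⟨Equiv.Set.univ _, Iff.rfl⟩)

theorem counit_toAF_eq_zero {G : Graph} (v : G.V) : counit k G.toAF = 0 :=
  if_neg fun h => ((Graph.toAF_eq_empty_iff G).1 h).elim v

theorem counit_empty : counit k AF.empty = 1 := if_pos rfl

theorem counit_comp (a : DualAF k) : comp (counit k) a = a := by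
  refine DualAF.ext_graph fun G => ?_
  rw [comp_toAF_eq_add, counit_empty, one_mul, Finset.sum_eq_zero, add_zero]
  rintro ⟨p, hp⟩ -
  obtain ⟨v, hv⟩ := (Set.ne_univ_iff_exists_notMem _).1 hp
  rw [counit_toAF_eq_zero (G := p.upper) ⟨v, hv⟩, zero_mul]

theorem comp_counit (a : DualAF k) : comp a (counit k) = a := by
  refine DualAF.ext_graph fun G => ?_
  rw [comp_toAF, Finset.sum_eq_single (⟨∅, fun _ h => h.elim⟩ : G.AdmissiblePartition)]
  · have h : ∀ p : G.AdmissiblePartition, p.R = ∅ → counit k p.lower.toAF = 1 := fun p hp =>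
      if_pos ((Graph.toAF_eq_empty_iff _).2 ⟨fun v : p.lower.V =>
        (iff_of_eq (congrArg (fun R : Set G.V => v.1 ∈ R) hp)).1 v.2⟩)
    rw [h _ rfl, mul_one]
    refine congrArg a (Graph.toAF_eq ⟨Equiv.subtypeUnivEquiv fun v h => h, Iff.rfl⟩)
  · intro p _ hp
    obtain ⟨v, hv⟩ : p.R.Nonempty := by
      by_contra h
      exact hp (Graph.AdmissiblePartition.ext (Set.not_nonempty_iff_eq_empty.1 h))
    rw [counit_toAF_eq_zero (G := p.lower) ⟨v, hv⟩, mul_zero]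
  · exact fun h => (h (Finset.mem_univ _)).elim

theorem comp_linear_left (α₁ α₂ : k) (a₁ a₂ a : DualAF k) :
    comp (α₁ • a₁ + α₂ • a₂) a = α₁ • comp a₁ a + α₂ • comp a₂ a := by
  refine DualAF.ext_graph fun G => ?_
  simp only [comp_toAF, Pi.add_apply, Pi.smul_apply, smul_eq_mul, Finset.mul_sum,
    ← Finset.sum_add_distrib]
  exact Finset.sum_congr rfl fun p _ => by ring

theorem comp_linear_right (α₁ α₂ : k) (a₁ a₂ a : DualAF k) :
    comp a (α₁ • a₁ + α₂ • a₂) = α₁ • comp a a₁ + α₂ • comp a a₂ := by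
  refine DualAF.ext_graph fun G => ?_
  simp only [comp_toAF, Pi.add_apply, Pi.smul_apply, smul_eq_mul, Finset.mul_sum,
    ← Finset.sum_add_distrib]
  exact Finset.sum_congr rfl fun p _ => by ring

theorem subst_linear (b : DualAT k) (α₁ α₂ : k) (a₁ a₂ : DualAF k) :
    subst b (α₁ • a₁ + α₂ • a₂) = α₁ • subst b a₁ + α₂ • subst b a₂ := by
  refine DualAF.ext_graph fun G => ?_
  simp only [subst_toAF, Pi.add_apply, Pi.smul_apply, smul_eq_mul, Finset.mul_sum,
    ← Finset.sum_add_distrib]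
  exact Finset.sum_congr rfl fun p _ => by ring

/-- Well-founded recursion for both kinds of inverse. Values at elements that are not smaller are
set to `0`, which `F` cannot see. -/
theorem existsUnique_of_size_recursion {X S : Type*} [Zero S] (size : X → ℕ)
    (F : X → (X → S) → S)
    (hF : ∀ x f g, (∀ y, size y < size x → f y = g y) → F x f = F x g) :
    ∃! f : X → S, ∀ x, f x = F x f := by
  let f : X → S := (measure size).wf.fix fun x rec =>
    F x fun y => if h : size y < size x then rec y h else 0
  have hf : ∀ x, f x = F x f := by
    intro x
    refine (WellFounded.fix_eq _ _ x).trans (hF x _ _ fun y hy => ?_)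
    exact dif_pos hy
  refine ⟨f, hf, fun g hg => funext fun x => ?_⟩
  induction hn : size x using Nat.strong_induction_on generalizing x with
  | _ n ih =>
    rw [hf, hg]
    exact hF x _ _ fun y hy => ih _ (hn ▸ hy) y rfl

/-- The number of nodes. -/
def AF.size : AF → ℕ :=
  Quotient.lift (fun G : Graph => Nat.card G.V) fun _ _ ⟨e⟩ => Nat.card_congr e.toEquiv

theorem comp_empty (a a' : DualAF k) : comp a a' AF.empty = a AF.empty * a' AF.empty := by
  refine (comp_toAF_eq_add a a' Graph.empty).trans ?_
  rw [Finset.sum_eq_zero, add_zero]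
  · rfl
  · rintro ⟨p, hp⟩ -
    exact absurd (Set.eq_univ_of_forall fun v => v.elim) hp

theorem exists_comp_eq_counit {a : DualAF k} (ha : a AF.empty ≠ 0) :
    ∃ x : DualAF k, comp a x = counit k := by
  obtain ⟨x, hx, -⟩ := existsUnique_of_size_recursion AF.size
    -- The equation `comp a x φ = counit k φ` solved for `x φ`. The subtraction removes the
    -- splitting with full lower part, so only smaller forests remain.
    (fun φ (x : DualAF k) => (counit k φ - (comp a x φ - a AF.empty * x φ)) / a AF.empty) <| by
      intro φ x y h
      obtain ⟨G, rfl⟩ := Quotient.exists_rep φ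
      change ∀ ψ, AF.size ψ < G.toAF.size → _ at h
      change (counit k G.toAF - (comp a x G.toAF - a AF.empty * x G.toAF)) / _ =
        (counit k G.toAF - (comp a y G.toAF - a AF.empty * y G.toAF)) / _
      rw [comp_toAF_eq_add, comp_toAF_eq_add, add_sub_cancel_left, add_sub_cancel_left]
      congr 2
      refine Finset.sum_congr rfl fun p _ => ?_
      rw [h p.1.lower.toAF]
      obtain ⟨v, hv⟩ := (Set.ne_univ_iff_exists_notMem _).1 p.2
      exact Finite.card_subtype_lt hv
  refine ⟨x, funext fun φ => ?_⟩
  have := hx φ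
  rw [eq_div_iff ha] at this
  linear_combination this

theorem exists_isCompInverse_iff (a : DualAF k) :
    (∃ a', IsCompInverse a a') ↔ a AF.empty ≠ 0 := by
  constructor
  · rintro ⟨a', h, -⟩ h0
    have := congrFun h AF.empty
    rw [comp_empty, h0, zero_mul, counit_empty] at this
    exact zero_ne_one this
  · intro ha
    obtain ⟨x, hx⟩ := exists_comp_eq_counit ha
    have hx0 : x AF.empty ≠ 0 := by
      intro h0
      have := congrFun hx AF.empty
      rw [comp_empty, h0, mul_zero, counit_empty] at this
      exact zero_ne_one this
    -- The right inverse `x` has a right inverse `y`, and associativity forces `y = a`.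
    obtain ⟨y, hy⟩ := exists_comp_eq_counit hx0
    refine ⟨x, hx, ?_⟩
    have : a = y := by rw [← comp_counit a, ← hy, ← comp_assoc, hx, counit_comp]
    rw [this, hy]

theorem subst_counit (b : DualAT k) : subst b (counit k) = counit k := by
  refine DualAF.ext_graph fun G => ?_
  rw [subst_toAF]
  rcases isEmpty_or_nonempty G.V with h | ⟨⟨v⟩⟩
  · let u : Unique G.RootMap :=
      ⟨⟨⟨id, fun _ => rfl, fun v hv => (hv rfl).elim⟩⟩, fun ρ =>
        Graph.RootMap.ext (Subsingleton.elim _ _)⟩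
    rw [Fintype.sum_unique, Fintype.prod_empty, mul_one]
    rw [(Graph.toAF_eq_empty_iff G).2 h, (Graph.toAF_eq_empty_iff _).2]
    exact ⟨fun r => h.elim r.1⟩
  · rw [counit_toAF_eq_zero v]
    refine Finset.sum_eq_zero fun ρ _ => ?_
    rw [counit_toAF_eq_zero (G := ρ.skel) (ρ.toFix v), zero_mul]

theorem IsCompInverse.subst (b : DualAT k) {a a' : DualAF k} (h : IsCompInverse a a') :
    IsCompInverse (subst b a) (subst b a') :=
  ⟨by rw [← subst_comp, h.1, subst_counit], by rw [← subst_comp, h.2, subst_counit]⟩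

theorem bulletDual_bullet : bulletDual k AT.bullet = 1 := if_pos rfl

theorem bulletDual_toAF_bullet : (bulletDual k).toAF Graph.bullet.toAF = 1 :=
  (DualAT.toAF_toAF _ Graph.bullet_hasOneRoot).trans bulletDual_bullet

theorem bulletDual_toAF_eq_zero {G : Graph} (h : G.toAF ≠ Graph.bullet.toAF) :
    (bulletDual k).toAF G.toAF = 0 := by
  by_cases hG : G.HasOneRoot
  · rw [DualAT.toAF_toAF _ hG]
    exact if_neg fun h' => h (congrArg Subtype.val h')
  · exact DualAT.toAF_eq_zero _ hG

theorem bulletDual_subst (a : DualAF k) : subst (bulletDual k) a = a := by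
  refine DualAF.ext_graph fun G => ?_
  rw [subst_toAF, Finset.sum_eq_single
    (⟨id, fun _ => rfl, fun v hv => (hv rfl).elim⟩ : G.RootMap)]
  · rw [Finset.prod_eq_one, mul_one]
    · refine congrArg a (Graph.toAF_eq ⟨Equiv.subtypeUnivEquiv fun _ => rfl, fun {r s} => ?_⟩)
      constructor
      · exact fun h => ⟨s.1, h, rfl⟩
      · rintro ⟨w, hw, rfl : w = s.1⟩
        exact hw
    -- A self-loop at a fixed vertex is cut, so each class really is a single node without edges;
    -- the loop reappears in the skeleton.
    · intro r _
      rw [Graph.toAF_eq_bullet (G := Graph.RootMap.part _ _) ⟨r.1, r.2⟩, bulletDual_toAF_bullet]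
      · exact fun v => Subtype.ext v.2
      · exact fun u v h => h.2 rfl
  · intro ρ _ hρ
    obtain ⟨v, hv⟩ : ∃ v, ρ.root v ≠ v := by
      by_contra! h
      exact hρ (Graph.RootMap.ext (funext h))
    rw [Finset.prod_eq_zero (Finset.mem_univ (ρ.toFix v)), mul_zero]
    refine bulletDual_toAF_eq_zero fun h => hv ?_
    have := Graph.subsingleton_of_toAF_eq_bullet h
    exact congrArg Subtype.val (this.elim
      (⟨ρ.root v, ρ.idem v⟩ : (ρ.part (ρ.root v)).V) ⟨v, rfl⟩)
  · exact fun h => (h (Finset.mem_univ _)).elim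

/-! ### The trivial partition and inverses for substitution -/

namespace Graph.Partition

variable {G : Graph}

/-- Cutting an edge inside the only class would turn its source into a second root besides the root
of `G`. Hence nontrivial partitions of a tree have several classes, all smaller than the tree. -/
theorem kept_eq_of_classes_eq_top (hG : G.HasOneRoot) (p : G.Partition) (h : p.classes = ⊤) :
    p.kept = G.graph := by
  refine le_antisymm p.kept_le fun u v huv => ?_
  by_contra hk
  obtain ⟨r, hr, -⟩ := hG
  have hidx : p.toIndex u = p.toIndex r := Quotient.sound (s := p.classes) <| by
    change p.classes u r
    rw [h]
    trivial
  have huniq := (p.part_hasOneRoot (p.toIndex r)).unique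
    (y₁ := ⟨u, hidx⟩) (y₂ := ⟨r, rfl⟩)
    (fun w hw => hk <| by
      have hw' : p.kept.Adj u w.1 := hw
      rwa [G.out_unique _ _ _ huv (p.kept_le hw')])
    (fun w hw => hr w.1 (p.kept_le hw))
  have : u = r := congrArg Subtype.val huniq
  exact hr v (this ▸ huv)

theorem isTrivial_iff_classes (hG : G.HasOneRoot) (p : G.Partition) :
    p.IsTrivial ↔ p.classes = ⊤ :=
  ⟨fun h => h.1, fun h => ⟨h, p.kept_eq_of_classes_eq_top hG h⟩⟩

theorem isTrivial_of_subsingleton_index (hG : G.HasOneRoot) (p : G.Partition)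
    (h : Subsingleton p.Index) : p.IsTrivial :=
  (p.isTrivial_iff_classes hG).2 <| Setoid.ext fun u v =>
    ⟨fun _ => trivial, fun _ => Quotient.exact (h.elim (p.toIndex u) (p.toIndex v))⟩

theorem IsTrivial.toIndex_eq {p : G.Partition} (h : p.IsTrivial) (u v : G.V) :
    p.toIndex u = p.toIndex v :=
  Quotient.sound (s := p.classes) <| by
    change p.classes u v
    rw [h.1]
    trivial

theorem IsTrivial.part_toAT {p : G.Partition} (hG : G.HasOneRoot) (h : p.IsTrivial)
    (B : p.Index) : (p.part B).toAT (p.part_hasOneRoot B) = G.toAT hG := by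
  obtain ⟨w, rfl⟩ := Quotient.exists_rep B
  refine Graph.toAT_eq ⟨Equiv.subtypeUnivEquiv fun v => h.toIndex_eq v w, fun {u v} => ?_⟩ _ _
  change G.graph.Adj u.1 v.1 ↔ p.kept.Adj u.1 v.1
  rw [h.2]

theorem IsTrivial.skeleton_toAF {p : G.Partition} (hG : G.HasOneRoot) (h : p.IsTrivial) :
    p.skeleton.toAF = Graph.bullet.toAF := by
  obtain ⟨r, -⟩ := hG
  refine Graph.toAF_eq_bullet (G := p.skeleton) (p.toIndex r) (fun B => ?_) ?_
  · obtain ⟨w, rfl⟩ := Quotient.exists_rep B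
    exact h.toIndex_eq w r
  · rintro _ _ ⟨u, v, -, -, h1, h2⟩
    exact h2 (h.2 ▸ h1)

/-- The trivial partition of a graph with one root. -/
def trivial (hG : G.HasOneRoot) : G.Partition where
  classes := ⊤
  kept := G.graph
  kept_le := le_rfl
  kept_classes := fun _ _ _ => True.intro
  oneRoot := by
    intro B
    obtain ⟨w, rfl⟩ := Quotient.exists_rep B
    refine Graph.Iso.hasOneRoot (Graph.Iso.symm ⟨⟨Equiv.subtypeUnivEquiv fun v => ?_, Iff.rfl⟩⟩) hG
    exact Quotient.sound (s := (⊤ : Setoid G.V)) True.intro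

theorem card_part_lt (hG : G.HasOneRoot) {p : G.Partition} (hp : ¬ p.IsTrivial) (B : p.Index) :
    Nat.card (p.part B).V < Nat.card G.V := by
  obtain ⟨w, hw⟩ : ∃ w, p.toIndex w ≠ B := by
    by_contra! h
    refine hp (p.isTrivial_of_subsingleton_index hG ⟨fun C D => ?_⟩)
    obtain ⟨u, rfl⟩ := Quotient.exists_rep C
    obtain ⟨v, rfl⟩ := Quotient.exists_rep D
    exact (h u).trans (h v).symm
  exact Finite.card_subtype_lt hw

end Graph.Partition

/-- The trivial partition has skeleton a single node and the whole graph as its only class; this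
isolates the one term containing `x` at `G` itself. -/
theorem substAT_toAT (x b : DualAT k) {G : Graph} (hG : G.HasOneRoot) :
    substAT x b (G.toAT hG) = b AT.bullet * x (G.toAT hG) +
      ∑ p : {p : G.Partition // ¬ p.IsTrivial}, b.toAF p.1.skeleton.toAF *
        ∏ B : p.1.Index, x ((p.1.part B).toAT (p.1.part_hasOneRoot B)) := by
  change substGraph x b.toAF G = _
  rw [substGraph, sum_eq_add_sum_not (fun p : G.Partition => p.IsTrivial)
    (Graph.Partition.trivial hG) fun p => ⟨fun h => Graph.Partition.ext h.1 h.2, fun h => by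
      rw [h]
      exact ⟨rfl, rfl⟩⟩]
  congr 1
  have h : (Graph.Partition.trivial hG).IsTrivial := ⟨rfl, rfl⟩
  generalize Graph.Partition.trivial hG = p at h
  rw [h.skeleton_toAF hG, DualAT.toAF_toAF _ Graph.bullet_hasOneRoot,
    Finset.prod_congr rfl fun B _ => congrArg x (h.part_toAT hG B)]
  obtain ⟨r, -⟩ := hG
  let u' : Unique p.Index := ⟨⟨p.toIndex r⟩, fun B => by
    obtain ⟨w, rfl⟩ := Quotient.exists_rep B
    exact h.toIndex_eq w r⟩
  rw [Fintype.prod_unique]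
  rfl

theorem substAT_bullet (x b : DualAT k) :
    substAT x b AT.bullet = b AT.bullet * x AT.bullet := by
  refine (substAT_toAT x b Graph.bullet_hasOneRoot).trans ?_
  rw [Finset.sum_eq_zero, add_zero]
  · rfl
  · rintro ⟨p, hp⟩ -
    refine absurd (p.isTrivial_of_subsingleton_index Graph.bullet_hasOneRoot ⟨fun C D => ?_⟩) hp
    obtain ⟨u, rfl⟩ := Quotient.exists_rep C
    obtain ⟨v, rfl⟩ := Quotient.exists_rep D
    rfl

theorem AT.exists_toAT (τ : AT) : ∃ (G : Graph) (hG : G.HasOneRoot), G.toAT hG = τ := by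
  obtain ⟨φ, h⟩ := τ
  obtain ⟨G, rfl⟩ := Quotient.exists_rep φ
  exact ⟨G, h, rfl⟩

theorem substAT_bulletDual (b : DualAT k) : substAT b (bulletDual k) = b := by
  funext τ
  obtain ⟨G, hG, rfl⟩ := τ.exists_toAT
  rw [substAT_toAT, bulletDual_bullet, one_mul, Finset.sum_eq_zero, add_zero]
  rintro ⟨p, hp⟩ -
  rw [bulletDual_toAF_eq_zero fun h => hp (p.isTrivial_of_subsingleton_index hG
    (Graph.subsingleton_of_toAF_eq_bullet h)), zero_mul]

theorem bulletDual_substAT (b : DualAT k) : substAT (bulletDual k) b = b :=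
  DualAT.toAF_injective <| by rw [substAT_toAF, bulletDual_subst]

theorem substAT_assoc (b c d : DualAT k) :
    substAT (substAT d c) b = substAT d (substAT c b) :=
  DualAT.toAF_injective <| by
    rw [substAT_toAF, substAT_toAF, substAT_toAF, subst_subst]

/-- The recursion is the left-inverse equation solved for the term of the trivial partition. -/
theorem isRecursiveInverse_iff {b : DualAT k} (hb : b AT.bullet ≠ 0) (b' : DualAT k) :
    IsRecursiveInverse b b' ↔ substAT b' b = bulletDual k := by
  constructor
  · rintro ⟨h0, h⟩
    funext τ
    obtain ⟨G, hG, rfl⟩ := τ.exists_toAT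
    by_cases hτ : G.toAT hG = AT.bullet
    · rw [hτ, substAT_bullet, h0, bulletDual_bullet, mul_one_div_cancel hb]
    · rw [substAT_toAT, h G hG hτ, bulletDual, if_neg hτ]
      field_simp
      ring
  · intro h
    refine ⟨?_, fun G hG hτ => ?_⟩
    · have := congrFun h AT.bullet
      rw [substAT_bullet, bulletDual_bullet] at this
      exact eq_one_div_of_mul_eq_one_right this
    · have := congrFun h (G.toAT hG)
      rw [substAT_toAT, bulletDual, if_neg hτ] at this
      field_simp
      linear_combination this

theorem existsUnique_substAT_eq_bulletDual {b : DualAT k} (hb : b AT.bullet ≠ 0) :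
    ∃! b' : DualAT k, substAT b' b = bulletDual k := by
  refine (existsUnique_congr fun x => ?_).1 (existsUnique_of_size_recursion
    (fun τ : AT => AF.size τ.1)
    (fun τ (x : DualAT k) =>
      -- The subtraction cancels the term of the trivial partition, leaving products of values of
      -- `x` at smaller trees.
      (bulletDual k τ - (substAT x b τ - b AT.bullet * x τ)) / b AT.bullet) ?_)
  · rw [funext_iff]
    refine forall_congr' fun τ => ?_
    rw [eq_div_iff hb]
    constructor
    · intro h
      linear_combination h
    · intro h
      linear_combination h
  · intro τ x y h
    obtain ⟨G, hG, rfl⟩ := τ.exists_toAT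
    rw [substAT_toAT, substAT_toAT, add_sub_cancel_left, add_sub_cancel_left]
    congr 2
    refine Finset.sum_congr rfl fun p _ => ?_
    congr 1
    exact Finset.prod_congr rfl fun B _ => h _ (Graph.Partition.card_part_lt hG p.2 B)

/-- The left inverse `b'` is nonzero at the single node, so it has a left inverse `c`, and
associativity gives `c = b`. -/
theorem substAT_comm_of_eq_bulletDual {b b' : DualAT k}
    (h : substAT b' b = bulletDual k) :
    b' AT.bullet ≠ 0 ∧ substAT b b' = bulletDual k := by
  have hb' : b' AT.bullet ≠ 0 := by
    intro h0
    have := congrFun h AT.bullet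
    rw [substAT_bullet, h0, mul_zero, bulletDual_bullet] at this
    exact zero_ne_one this
  obtain ⟨c, hc, -⟩ := existsUnique_substAT_eq_bulletDual hb'
  have : c = b := by
    rw [← substAT_bulletDual c, ← h, ← substAT_assoc, hc, bulletDual_substAT]
  exact ⟨hb', this ▸ hc⟩

end Aromatic

end

theorem proposition5p4 (k : Type*) [Field k] :
    -- the series indexed by aromatic forests form an algebra under the composition product
    ((∀ a₁ a₂ a₃ : DualAF k, comp (comp a₁ a₂) a₃ = comp a₁ (comp a₂ a₃)) ∧
      (∀ a : DualAF k, comp (counit k) a = a ∧ comp a (counit k) = a) ∧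
      (∀ (α₁ α₂ : k) (a₁ a₂ a : DualAF k),
        comp (α₁ • a₁ + α₂ • a₂) a = α₁ • comp a₁ a + α₂ • comp a₂ a ∧
        comp a (α₁ • a₁ + α₂ • a₂) = α₁ • comp a a₁ + α₂ • comp a a₂) ∧
      (∀ a : DualAF k, (∃ a' : DualAF k, IsCompInverse a a') ↔ a AF.empty ≠ 0)) ∧
    -- (a) the monoid of series indexed by aromatic trees
    ((∀ b c : DualAT k, (substAT c b).toAF = subst c b.toAF) ∧
      (∀ b c d : DualAT k, substAT (substAT d c) b = substAT d (substAT c b)) ∧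
      (∀ b : DualAT k, substAT (bulletDual k) b = b ∧ substAT b (bulletDual k) = b)) ∧
    -- (a) its action by algebra morphisms
    ((∀ (b : DualAT k) (α₁ α₂ : k) (a₁ a₂ : DualAF k),
        subst b (α₁ • a₁ + α₂ • a₂) = α₁ • subst b a₁ + α₂ • subst b a₂) ∧
      (∀ (b c : DualAT k) (a : DualAF k), subst c (subst b a) = subst (substAT c b) a) ∧
      (∀ b : DualAT k, subst b (bulletDual k).toAF = b.toAF) ∧
      (∀ a : DualAF k, subst (bulletDual k) a = a) ∧
      (∀ (b : DualAT k) (a₁ a₂ : DualAF k),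
        subst b (comp a₁ a₂) = comp (subst b a₁) (subst b a₂)) ∧
      (∀ b : DualAT k, subst b (counit k) = counit k) ∧
      (∀ (b : DualAT k) (a a' : DualAF k),
        IsCompInverse a a' → IsCompInverse (subst b a) (subst b a'))) ∧
    -- (b) the group of the series with nonzero coefficient at the single node
    ((∀ b c : DualAT k, b AT.bullet ≠ 0 → c AT.bullet ≠ 0 → substAT c b AT.bullet ≠ 0) ∧
      bulletDual k AT.bullet ≠ 0 ∧
      (∀ b : DualAT k, b AT.bullet ≠ 0 →
        (∃! b' : DualAT k, IsRecursiveInverse b b') ∧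
        ∀ b' : DualAT k, IsRecursiveInverse b b' →
          b' AT.bullet ≠ 0 ∧ substAT b b' = bulletDual k ∧ substAT b' b = bulletDual k)) := by
  refine ⟨⟨comp_assoc, fun a => ⟨counit_comp a, comp_counit a⟩, fun α₁ α₂ a₁ a₂ a =>
    ⟨comp_linear_left α₁ α₂ a₁ a₂ a, comp_linear_right α₁ α₂ a₁ a₂ a⟩, exists_isCompInverse_iff⟩,
    ⟨fun b c => substAT_toAF c b, substAT_assoc,
      fun b => ⟨bulletDual_substAT b, substAT_bulletDual b⟩⟩,
    ⟨subst_linear, subst_subst, fun b => ?_, bulletDual_subst, subst_comp, subst_counit,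
      fun b _ _ h => h.subst b⟩,
    ⟨fun b c hb hc => ?_, ?_, fun b hb => ⟨?_, fun b' h => ?_⟩⟩⟩
  · rw [← substAT_toAF, substAT_bulletDual]
  · rw [substAT_bullet]
    exact mul_ne_zero hb hc
  · rw [bulletDual_bullet]
    exact one_ne_zero
  · exact (existsUnique_congr fun b' => isRecursiveInverse_iff hb b').2
      (existsUnique_substAT_eq_bulletDual hb)
  · have h' := (isRecursiveInverse_iff hb b').1 h
    obtain ⟨h1, h2⟩ := substAT_comm_of_eq_bulletDual h'
    exact ⟨h1, h2, h'⟩
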